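/- Let $(\Omega,\mathcal F,\mathbb F=\{\mathcal F_t\}_{t\in[0,1]},\mathbb P)$ be a filtered probability space and let $X=\{X(t),t\in[0,1]\}$ be a real-valued $\mathbb F$-adapted process. Assume: 1. (Hölder) there is $\alpha>\tfrac12$ such that almost surely there is a finite constant $C>0$ (possibly depending on $\omega$) with $|X(t)-X(s)|\le C|t-s|^{\alpha}$ for all $s,t\in[0,1]$; 2. (small ball) there are constants $\delta>0$ and $C>0$ such that for all $s<t$ in $[1-\delta,1]\cap[0,1]$, with $\Delta=t-s$, and all $0<\varepsilon\le\Delta^{\alpha}$, $$\mathbb P\Big(\sup_{s\le u\le t}|X(u)-X(s)|\le\varepsilon\Big)\le\exp\big(-C\Delta\,\varepsilon^{-1/\alpha}\big);$$ 3. there is $v\in(1-\delta,1)\cap[0,1]$ such that the distribution function of $X(v)$ is continuous. Then for every distribution function $F$ on $\mathbb R$ (non-decreasing, right-continuous, with limits $0$ at $-\infty$ and $1$ at $+\infty$) there exist $\beta\in(1-\alpha,1)$ and an $\mathbb F$-adapted process $\varphi=\{\varphi(t),t\in[0,1]\}$ such that, almost surely, the integral $\int_0^1\varphi(s)\,\mathrm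 dX(s)$ exists as a generalized Lebesgue–Stieltjes integral of order $\beta$, and this integral is a random variable with distribution function $F$. Here, for $\beta\in(0,1)$, $f,g\colon[a,b]\to\mathbb R$ and $g_{b-}(x)=g(x)-g(b)$, the generalized Lebesgue–Stieltjes integral is $$\int_a^b f\,\mathrm dg=e^{i\pi\beta}\int_a^b\big(D_{a+}^{\beta}f\big)(x)\,\big(D_{b-}^{1-\beta}g_{b-}\big)(x)\,\mathrm dx,$$ $$\big(D_{a+}^{\beta}f\big)(x)=\frac{1}{\Gamma(1-\beta)}\Big(\frac{f(x)}{(x-a)^{\beta}}+\beta\int_a^x\frac{f(x)-f(u)}{(x-u)^{\beta+1}}\,\mathrm du\Big),$$ $$\big(D_{b-}^{1-\beta}g\big)(x)=\frac{e^{i\pi(1-\beta)}}{\Gamma(\beta)}\Big(\frac{g(x)}{(b-x)^{1-\beta}}+(1-\beta)\int_x^b\frac{g(x)-g(u)}{(u-x)^{2-\beta}}\,\mathrm du\Big),$$ and it is said to exist if $f$ is measurable, $D_{a+}^{\beta}f\in L_1[a,b]$, $D_{b-}^{1-\beta}g_{b-}\in L_\infty[a,b]$ (the inner integrals converging absolutely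 for almost every $x$), and $$\int_a^b\Big(\frac{|f(t)|}{(t-a)^{\beta}}+\int_a^t\frac{|f(t)-f(s)|}{(t-s)^{\beta+1}}\,\mathrm ds\Big)\mathrm dt<\infty.$$ -/

import Mathlib

open MeasureTheory ProbabilityTheory Set Filter Topology
open scoped ENNReal unitInterval

noncomputable section

namespace GLS

/-- Left-sided fractional (Weyl) derivative `D_{a+}^β f` on an interval starting at `a`. -/
def leftDeriv (β a : ℝ) (f : ℝ → ℝ) (x : ℝ) : ℝ :=
  1 / Real.Gamma (1 - β) *
    (f x / (x - a) ^ β + β * ∫ u in Ioc a x, (f x - f u) / (x - u) ^ (β + 1))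

/-- Right-sided fractional (Weyl) derivative `D_{b-}^{1-β} g` on an interval ending at `b`,
with its customary complex phase `(-1)^{1-β} = e^{iπ(1-β)}`. -/
def rightDeriv (β b : ℝ) (g : ℝ → ℝ) (x : ℝ) : ℂ :=
  Complex.exp (Complex.I * Real.pi * (1 - β)) / (Real.Gamma β : ℂ) *
    ((g x / (b - x) ^ (1 - β) +
      (1 - β) * ∫ u in Ioc x b, (g x - g u) / (u - x) ^ (2 - β) : ℝ) : ℂ)

/-- The norm `‖f‖_{β;[a,b]}`, as an extended nonnegative number. -/
def fracNorm (β a b : ℝ) (f : ℝ → ℝ) : ℝ≥0∞ :=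
  ∫⁻ t in Ioc a b, (ENNReal.ofReal (|f t| / (t - a) ^ β) +
    ∫⁻ s in Ioc a t, ENNReal.ofReal (|f t - f s| / (t - s) ^ (β + 1)))

/-- The generalized Lebesgue-Stieltjes integral `∫_a^b f dg`, computed with the fractional
order `β`, exists (`f` being an admissible integrand of order `β`) and equals `J`. -/
structure HasIntegral (β a b : ℝ) (f g : ℝ → ℝ) (J : ℝ) : Prop where
  order_mem : β ∈ Ioo (0 : ℝ) 1
  aemeasurable : AEMeasurable f (volume.restrict (Ioc a b))
  /-- Admissibility; in particular the inner integral in `leftDeriv` converges absolutely for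
  almost every `x`. -/
  fracNorm_lt_top : fracNorm β a b f < ∞
  left_memLp : MemLp (leftDeriv β a f) 1 (volume.restrict (Ioc a b))
  /-- The inner integral in `rightDeriv` converges absolutely for almost every `x`. -/
  right_inner : ∀ᵐ x ∂(volume.restrict (Ioc a b)),
    IntegrableOn (fun u => (g x - g u) / (u - x) ^ (2 - β)) (Ioc x b)
  right_memLp : MemLp (rightDeriv β b (fun x => g x - g b)) ∞ (volume.restrict (Ioc a b))
  value : (J : ℂ) = Complex.exp (Complex.I * Real.pi * β) *
    ∫ x in Ioc a b, (leftDeriv β a f x : ℂ) * rightDeriv β b (fun x => g x - g b) x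

end GLS

/-- A path on `[0,1]` as a function on `ℝ` (constant outside `[0,1]`; only the values on `[0,1]`
enter integrals over `[0,1]`). -/
def extendPath {Ω : Type*} (X : I → Ω → ℝ) (ω : Ω) : ℝ → ℝ :=
  IccExtend zero_le_one (fun t : Icc (0 : ℝ) 1 => X t ω)

/-- Almost every path is Hölder continuous of order `α` on `[0,1]`. -/
def HolderPaths {Ω : Type*} [MeasurableSpace Ω] (P : Measure Ω) (X : I → Ω → ℝ) (α : ℝ) : Prop :=
  ∀ᵐ ω ∂P, ∃ C : ℝ, 0 < C ∧ ∀ s t : I, |X t ω - X s ω| ≤ C * |(t : ℝ) - s| ^ α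

/-- Small ball estimate on `[1-δ,1]`; the event is `sup_{s ≤ u ≤ t} |X(u) - X(s)| ≤ ε`. -/
def SmallBall {Ω : Type*} [MeasurableSpace Ω] (P : Measure Ω) (X : I → Ω → ℝ) (α δ : ℝ) : Prop :=
  ∃ C : ℝ, 0 < C ∧ ∀ s t : I, 1 - δ ≤ (s : ℝ) → s < t → ∀ ε : ℝ, 0 < ε →
    ε ≤ ((t : ℝ) - s) ^ α →
    P.real {ω | ∀ u ∈ Icc s t, |X u ω - X s ω| ≤ ε} ≤
      Real.exp (-C * ((t : ℝ) - s) * ε ^ (-(1 / α)))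

/-- `F` is the distribution function of a probability measure on `ℝ`. -/
structure IsDistributionFunction (F : ℝ → ℝ) : Prop where
  mono : Monotone F
  right_cont : ∀ x, ContinuousWithinAt F (Ici x) x
  tendsto_atBot : Tendsto F atBot (𝓝 0)
  tendsto_atTop : Tendsto F atTop (𝓝 1)

end

noncomputable section

/-! ### Power and beta integrals. -/

namespace GLS

/-! The target is known at time `v`: since the law of `X v` has no atoms, `ξ = quantile F (cdf (X
v))` has distribution function `F` (`cdf_map_quantile`). It remains to trade on `[v, 1)` so that the
gain hits `|ξ|` exactly, and to multiply the position by the sign of `ξ`.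

Cut `[v, 1)` into infinitely many blocks accumulating at `1`. Holding `2 c (X - X(node))` on a fine
grid gains `c (X - X(node)) ^ 2` up to `c` times the sum of squared increments, and this error
vanishes with the mesh because `α > 1 / 2`. With `c = 1 / level ^ 2`, a block on which the path
leaves the ball of radius `2 * level` earns at least `1 / 2`, once the block index dominates the
random Hölder constant (`IsTuned.eventually_block_gain`). The small ball estimate and Borel-Cantelli
give such an exit in all but finitely many blocks (`IsTuned.ae_eventually_exit`), so the gain
diverges along the nodes. Being continuous in time and starting at `0`, it equals `|ξ|` at some `τ <
1` (`exists_stopping_time`).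

Stopping at `τ` leaves, for each `ω`, a step function with finitely many jumps. Its fractional
integral is the Riemann-Stieltjes sum (`hasIntegral_stepFun`): the left derivative of an indicator
is a difference of power kernels, and integrating such a kernel against the right derivative of `g`
recovers the increments of `g` (`integral_weyl`). -/

theorem integrableOn_sub_rpow_left {r : ℝ} (hr : -1 < r) (a b : ℝ) :
    IntegrableOn (fun u => (u - a) ^ r) (Ioc a b) := by
  rcases le_or_gt a b with hab | hab
  · rw [← intervalIntegrable_iff_integrableOn_Ioc_of_le hab]
    have := (intervalIntegral.intervalIntegrable_rpow' hr (a := 0) (b := b - a)).comp_sub_right a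
    simpa using this
  · simp [Ioc_eq_empty (not_lt.2 hab.le)]

theorem setIntegral_sub_rpow_left {r : ℝ} (hr : -1 < r) {a b : ℝ} (hab : a ≤ b) :
    ∫ u in Ioc a b, (u - a) ^ r = (b - a) ^ (r + 1) / (r + 1) := by
  rw [← intervalIntegral.integral_of_le hab,
    intervalIntegral.integral_comp_sub_right (fun u => u ^ r) a, integral_rpow (Or.inl hr)]
  simp [Real.zero_rpow (by linarith : r + 1 ≠ 0)]

/-- The Euler beta integral `B(1 - β, β)` over an arbitrary interval. -/
theorem setIntegral_beta {β : ℝ} (h0 : 0 < β) (h1 : β < 1) {s u : ℝ} (hsu : s < u) :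
    ∫ x in Ioc s u, (x - s) ^ (-β) * (u - x) ^ (β - 1) =
      Real.Gamma (1 - β) * Real.Gamma β := by
  have ha : 0 < u - s := sub_pos.2 hsu
  have h := Complex.betaIntegral_scaled ((1 - β : ℝ) : ℂ) (β : ℂ) ha
  have hG := Complex.Gamma_mul_Gamma_eq_betaIntegral (s := ((1 - β : ℝ) : ℂ)) (t := (β : ℂ))
    (by simpa using h1) (by simpa using h0)
  have e : ((1 - β : ℝ) : ℂ) + β = 1 := by push_cast; ring
  rw [e, Complex.Gamma_one, one_mul] at hG
  rw [e, sub_self, Complex.cpow_zero, one_mul, ← hG, intervalIntegral.integral_of_le ha.le] at h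
  have h2 : ∫ x in Ioc s u, (x - s) ^ (-β) * (u - x) ^ (β - 1) =
      ∫ y in Ioc 0 (u - s), y ^ (-β) * ((u - s) - y) ^ (β - 1) := by
    rw [← intervalIntegral.integral_of_le hsu.le, ← intervalIntegral.integral_of_le ha.le]
    have := intervalIntegral.integral_comp_sub_right (a := s) (b := u)
      (fun y : ℝ => y ^ (-β) * ((u - s) - y) ^ (β - 1)) s
    simp only [sub_self] at this
    rw [← this]
    congr 1; ext x; ring_nf
  rw [h2]
  apply Complex.ofReal_injective
  rw [← integral_complex_ofReal, Complex.ofReal_mul, ← Complex.Gamma_ofReal,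
    ← Complex.Gamma_ofReal, ← h]
  refine setIntegral_congr_fun measurableSet_Ioc fun x hx => ?_
  simp only [Complex.ofReal_mul]
  rw [Complex.ofReal_cpow hx.1.le, Complex.ofReal_cpow (by linarith [hx.2])]
  push_cast
  congr 2
  ring

/-- A Bochner integral with a nonzero value can only come from an integrable function, so the
evaluation above suffices. -/
theorem integrableOn_beta {β : ℝ} (h0 : 0 < β) (h1 : β < 1) (s u : ℝ) :
    IntegrableOn (fun x => (x - s) ^ (-β) * (u - x) ^ (β - 1)) (Ioc s u) := by
  rcases lt_or_ge s u with hsu | hsu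
  · apply Integrable.of_integral_ne_zero
    rw [setIntegral_beta h0 h1 hsu]
    exact mul_ne_zero (Real.Gamma_pos_of_pos (by linarith)).ne' (Real.Gamma_pos_of_pos h0).ne'
  · simp [Ioc_eq_empty (not_lt.2 hsu)]

/-! ### The right-sided derivative of a Hölder function. -/

/-- The real factor of the right-sided Weyl derivative of order `1 - β` of `g - g 1` on `[0, 1]`,
without the Gamma normalisation. -/
def weyl (β : ℝ) (g : ℝ → ℝ) (x : ℝ) : ℝ :=
  (g x - g 1) / (1 - x) ^ (1 - β) + (1 - β) * ∫ u in Ioc x 1, (g x - g u) / (u - x) ^ (2 - β)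

theorem rightDeriv_eq_weyl (β : ℝ) (g : ℝ → ℝ) (x : ℝ) :
    rightDeriv β 1 (fun x => g x - g 1) x =
      Complex.exp (Complex.I * Real.pi * (1 - β)) / (Real.Gamma β : ℂ) * (weyl β g x : ℂ) := by
  simp [rightDeriv, weyl]

theorem continuous_of_holder {g : ℝ → ℝ} {α C : ℝ} (hα : 0 < α)
    (hg : ∀ s t, |g t - g s| ≤ C * |t - s| ^ α) : Continuous g := by
  rw [continuous_iff_continuousAt]
  intro s
  rw [ContinuousAt, tendsto_iff_dist_tendsto_zero]
  refine squeeze_zero (fun _ => dist_nonneg) (fun t => hg s t) ?_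
  have : Continuous fun t : ℝ => C * |t - s| ^ α :=
    continuous_const.mul ((by fun_prop : Continuous fun t : ℝ => |t - s|).rpow_const
      fun _ => Or.inr hα.le)
  simpa [Real.zero_rpow hα.ne'] using this.tendsto s

section Holder

variable {g : ℝ → ℝ} {α β C : ℝ}

theorem abs_weyl_integrand_le (hg : ∀ s t, |g t - g s| ≤ C * |t - s| ^ α) {x u : ℝ}
    (hxu : x < u) : |(g x - g u) / (u - x) ^ (2 - β)| ≤ C * (u - x) ^ (α + β - 2) := by
  have h : 0 < u - x := sub_pos.2 hxu
  rw [abs_div, abs_of_pos (Real.rpow_pos_of_pos h _), div_le_iff₀ (Real.rpow_pos_of_pos h _),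
    mul_assoc, ← Real.rpow_add h, abs_sub_comm]
  have := hg x u
  rw [abs_of_pos h] at this
  rwa [show α + β - 2 + (2 - β) = α by ring]

theorem integrableOn_weyl_integrand (hα : 0 < α) (hβ : 1 - α < β)
    (hg : ∀ s t, |g t - g s| ≤ C * |t - s| ^ α) (x : ℝ) :
    IntegrableOn (fun u => (g x - g u) / (u - x) ^ (2 - β)) (Ioc x 1) := by
  have hc := (continuous_of_holder hα hg).measurable
  refine ((integrableOn_sub_rpow_left (r := α + β - 2) (by linarith) x 1).const_mul C).mono'
    (Measurable.aestronglyMeasurable (by fun_prop)) ?_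
  filter_upwards [self_mem_ae_restrict measurableSet_Ioc] with u hu
  exact abs_weyl_integrand_le hg hu.1

/-- The bound sees `g` only through its Hölder data. It gives membership in `L∞`, and also a common
dominating constant for all smoothings of `g`. -/
theorem abs_weyl_le (hβ : 1 - α < β) (hβ1 : β < 1)
    (hg : ∀ s t, |g t - g s| ≤ C * |t - s| ^ α) {x : ℝ} (hx : x ∈ Ioo (0 : ℝ) 1) :
    |weyl β g x| ≤ C + (1 - β) * (C / (α + β - 1)) := by
  have h : 0 < 1 - x := sub_pos.2 hx.2
  have hC : 0 ≤ C := by simpa using (abs_nonneg _).trans (hg 0 1)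
  have hle : (1 - x) ^ (α + β - 1) ≤ 1 :=
    Real.rpow_le_one h.le (by linarith [hx.1]) (by linarith)
  refine (abs_add_le _ _).trans (add_le_add ?_ ?_)
  · rw [abs_div, abs_of_pos (Real.rpow_pos_of_pos h _), div_le_iff₀ (Real.rpow_pos_of_pos h _),
      abs_sub_comm]
    refine (hg x 1).trans ?_
    rw [abs_of_pos h]
    exact mul_le_mul_of_nonneg_left (Real.rpow_le_rpow_of_exponent_ge h (by linarith [hx.1])
      (by linarith)) hC
  · rw [abs_mul, abs_of_pos (by linarith : 0 < 1 - β)]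
    refine mul_le_mul_of_nonneg_left ?_ (by linarith)
    have hi := integrableOn_sub_rpow_left (r := α + β - 2) (by linarith) x 1
    rw [← Real.norm_eq_abs]
    refine (norm_integral_le_of_norm_le (hi.const_mul C) ?_).trans ?_
    · filter_upwards [self_mem_ae_restrict measurableSet_Ioc] with u hu
      exact abs_weyl_integrand_le hg hu.1
    · rw [integral_const_mul, setIntegral_sub_rpow_left (by linarith) hx.2.le]
      have e : α + β - 2 + 1 = α + β - 1 := by ring
      rw [e, mul_div_assoc']
      exact div_le_div_of_nonneg_right (mul_le_of_le_one_right hC hle) (by linarith)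

theorem measurable_weyl (hgm : Measurable g) : Measurable (weyl β g) := by
  unfold weyl
  refine Measurable.add (by fun_prop) (Measurable.const_mul ?_ _)
  have h : StronglyMeasurable (Function.uncurry fun x u : ℝ =>
      (Ioc x 1).indicator (fun u => (g x - g u) / (u - x) ^ (2 - β)) u) := by
    have : (Function.uncurry fun x u : ℝ =>
        (Ioc x 1).indicator (fun u => (g x - g u) / (u - x) ^ (2 - β)) u) =
        {p : ℝ × ℝ | p.1 < p.2 ∧ p.2 ≤ 1}.indicator
          fun p => (g p.1 - g p.2) / (p.2 - p.1) ^ (2 - β) := by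
      ext ⟨x, u⟩
      simp [indicator, Function.uncurry]
    rw [this]
    refine (Measurable.indicator (by fun_prop) ?_).stronglyMeasurable
    exact (measurableSet_lt measurable_fst measurable_snd).inter
      (measurableSet_le measurable_snd measurable_const)
  convert (h.integral_prod_right (ν := volume)).measurable using 2 with x
  exact (integral_indicator measurableSet_Ioc).symm

end Holder

/-! ### Inversion of the right-sided derivative. -/

section Inversion

variable {g g' : ℝ → ℝ} {α β C : ℝ}

/-- Integration by parts for `(g x - g u) * (u - x) ^ (β - 1)`. Its value at `u = x` vanishes
because it is `O((u - x) ^ (α + β - 1))`, and its value at `u = 1` cancels the first term of `weyl`.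
-/
theorem weyl_eq_of_hasDerivAt (hα : 0 < α) (hβ : 1 - α < β) (hβ0 : 0 < β)
    (hg : ∀ s t, |g t - g s| ≤ C * |t - s| ^ α) (hd : ∀ x, HasDerivAt g (g' x) x)
    (hc : Continuous g') {x : ℝ} (hx : x < 1) :
    weyl β g x = -∫ u in Ioc x 1, g' u * (u - x) ^ (β - 1) := by
  have hgc := continuous_of_holder hα hg
  have hk : IntegrableOn (fun u => g' u * (u - x) ^ (β - 1)) (Ioc x 1) := by
    rw [← intervalIntegrable_iff_integrableOn_Ioc_of_le hx.le]
    refine IntervalIntegrable.continuousOn_mul ?_ hc.continuousOn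
    rw [intervalIntegrable_iff_integrableOn_Ioc_of_le hx.le]
    exact integrableOn_sub_rpow_left (by linarith) x 1
  have hk' : Integrable (fun u => -(g' u * (u - x) ^ (β - 1))) (volume.restrict (Ioc x 1)) := hk.neg
  have hw := (integrableOn_weyl_integrand hα hβ hg x).const_mul (1 - β)
  have key := intervalIntegral.integral_eq_sub_of_hasDerivAt_of_le hx.le
    (f := fun u => (g x - g u) * (u - x) ^ (β - 1))
    (f' := fun u => -(g' u * (u - x) ^ (β - 1)) - (1 - β) * ((g x - g u) / (u - x) ^ (2 - β)))
    ?_ ?_ ?_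
  · rw [intervalIntegral.integral_of_le hx.le, integral_sub hk' hw, integral_neg,
      integral_const_mul] at key
    have h : (1 - x) ^ (β - 1) = ((1 - x) ^ (1 - β))⁻¹ := by
      rw [← Real.rpow_neg (by linarith), neg_sub]
    simp only [sub_self, zero_mul, sub_zero, h] at key
    rw [weyl, div_eq_mul_inv, ← key]
    ring
  · intro u hu
    rcases hu.1.eq_or_lt with rfl | hu'
    · rw [ContinuousWithinAt, sub_self, zero_mul, tendsto_zero_iff_norm_tendsto_zero]
      have hlim : Tendsto (fun u => C * (u - x) ^ (α + β - 1)) (𝓝[Icc x 1] x) (𝓝 0) := by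
        have : Continuous fun u : ℝ => C * (u - x) ^ (α + β - 1) :=
          continuous_const.mul ((by fun_prop : Continuous fun u : ℝ => u - x).rpow_const
            fun _ => Or.inr (by linarith))
        have h2 := this.tendsto x
        simp only [sub_self, Real.zero_rpow (by linarith : α + β - 1 ≠ 0), mul_zero] at h2
        exact h2.mono_left inf_le_left
      refine squeeze_zero' (Eventually.of_forall fun _ => norm_nonneg _) ?_ hlim
      filter_upwards [self_mem_nhdsWithin] with u hu
      rcases hu.1.eq_or_lt with rfl | h
      · simp [Real.zero_rpow (by linarith : α + β - 1 ≠ 0)]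
      · have hp : 0 < u - x := sub_pos.2 h
        rw [norm_mul, Real.norm_eq_abs, Real.norm_of_nonneg (Real.rpow_pos_of_pos hp _).le,
          show α + β - 1 = α + (β - 1) by ring, Real.rpow_add hp, ← mul_assoc, abs_sub_comm]
        have := hg x u
        rw [abs_of_pos hp] at this
        exact mul_le_mul_of_nonneg_right this (Real.rpow_pos_of_pos hp _).le
    · refine ContinuousAt.continuousWithinAt ?_
      exact (by fun_prop : ContinuousAt (fun u => g x - g u) u).mul
        ((by fun_prop : ContinuousAt (fun u => u - x) u).rpow_const
          (Or.inl (sub_pos.2 hu').ne'))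
  · intro u hu
    have hp : 0 < u - x := sub_pos.2 hu.1
    have h1 : HasDerivAt (fun u => (u - x) ^ (β - 1)) (1 * (β - 1) * (u - x) ^ (β - 1 - 1)) u :=
      ((hasDerivAt_id u).sub_const x).rpow_const (Or.inl hp.ne')
    refine (((hd u).const_sub (g x)).mul h1).congr_deriv ?_
    rw [show β - 1 - 1 = -(2 - β) by ring, Real.rpow_neg hp.le]
    ring
  · rw [intervalIntegrable_iff_integrableOn_Ioc_of_le hx.le]
    exact hk'.sub hw

/-- Fubini on the triangle `s < x < u ≤ 1`: for fixed `u`, the integral in `x` is a beta integral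
whose value does not depend on `u`, so only `∫ g'` is left. -/
theorem integral_weyl_of_hasDerivAt (hα : 0 < α) (hβ : 1 - α < β) (hβ0 : 0 < β) (hβ1 : β < 1)
    (hg : ∀ s t, |g t - g s| ≤ C * |t - s| ^ α) (hd : ∀ x, HasDerivAt g (g' x) x)
    (hc : Continuous g') {s : ℝ} (hs : s ≤ 1) :
    ∫ x in Ioc s 1, (x - s) ^ (-β) * weyl β g x =
      Real.Gamma (1 - β) * Real.Gamma β * (g s - g 1) := by
  set μ := (volume : Measure ℝ).restrict (Ioc s 1) with hμ
  have hcm := hc.measurable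
  let K : ℝ → ℝ → ℝ := fun x u =>
    (Iio u).indicator (fun x => (x - s) ^ (-β) * (u - x) ^ (β - 1)) x * g' u
  have hrestr : ∀ u ∈ Ioc s 1, ∀ f : ℝ → ℝ, ∫ x, (Iio u).indicator f x ∂μ = ∫ x in Ioc s u, f x := by
    intro u hu f
    rw [integral_indicator measurableSet_Iio, hμ, Measure.restrict_restrict measurableSet_Iio,
      integral_Ioc_eq_integral_Ioo]
    congr 2
    ext y
    simp only [mem_inter_iff, mem_Iio, mem_Ioc, mem_Ioo]
    constructor
    · rintro ⟨h1, h2, h3⟩; exact ⟨h2, h1⟩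
    · rintro ⟨h1, h2⟩; exact ⟨h2, h1, by linarith [hu.2]⟩
  have hKm : Measurable (Function.uncurry K) := by
    have : Function.uncurry K = {p : ℝ × ℝ | p.1 < p.2}.indicator
        (fun p => (p.1 - s) ^ (-β) * (p.2 - p.1) ^ (β - 1) * g' p.2) := by
      ext ⟨x, u⟩
      simp [K, indicator, Function.uncurry]
    rw [this]
    exact Measurable.indicator (by fun_prop) (measurableSet_lt measurable_fst measurable_snd)
  have hnn : ∀ u, ∀ x ∈ Ioc s 1,
      0 ≤ (Iio u).indicator (fun x => (x - s) ^ (-β) * (u - x) ^ (β - 1)) x := by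
    intro u x hx
    refine indicator_apply_nonneg fun hxu => ?_
    exact mul_nonneg (Real.rpow_nonneg (by linarith [hx.1]) _)
      (Real.rpow_nonneg (by linarith [mem_Iio.1 hxu]) _)
  have hKint : Integrable (Function.uncurry K) (μ.prod μ) := by
    rw [integrable_prod_iff' hKm.aestronglyMeasurable]
    constructor
    · filter_upwards [self_mem_ae_restrict measurableSet_Ioc] with u hu
      refine Integrable.mul_const (𝕜 := ℝ) ?_ (g' u)
      change Integrable ((Iio u).indicator fun x => (x - s) ^ (-β) * (u - x) ^ (β - 1)) μ
      rw [integrable_indicator_iff measurableSet_Iio, IntegrableOn, hμ,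
        Measure.restrict_restrict measurableSet_Iio]
      refine (integrableOn_beta hβ0 hβ1 s u).mono_set ?_
      rintro y ⟨h1, h2⟩
      exact ⟨h2.1, (mem_Iio.1 h1).le⟩
    -- The power kernel is nonnegative, so the absolute integral in `x` is the same beta integral
    -- times `|g' u|`.
    · have hb : Integrable (fun u => Real.Gamma (1 - β) * Real.Gamma β * |g' u|) μ :=
        ((hc.abs.integrableOn_Icc (a := s) (b := 1)).mono_set Ioc_subset_Icc_self).const_mul _
      refine hb.congr ?_
      filter_upwards [self_mem_ae_restrict measurableSet_Ioc] with u hu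
      rw [← setIntegral_beta hβ0 hβ1 hu.1, ← hrestr u hu, ← integral_mul_const]
      refine integral_congr_ae ?_
      filter_upwards [self_mem_ae_restrict measurableSet_Ioc] with x hx
      simp only [Function.uncurry, K, norm_mul, Real.norm_eq_abs, abs_of_nonneg (hnn u x hx)]
  have hswap := integral_integral_swap hKint
  have hL : ∫ x, ∫ u, K x u ∂μ ∂μ = -∫ x in Ioc s 1, (x - s) ^ (-β) * weyl β g x := by
    rw [← integral_neg]
    refine integral_congr_ae ?_
    filter_upwards [self_mem_ae_restrict measurableSet_Ioc,
      ae_restrict_of_ae (measure_eq_zero_iff_ae_notMem.1 (measure_singleton (1 : ℝ)))] with x hx hx1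
    have hx1 : x < 1 := lt_of_le_of_ne hx.2 hx1
    rw [weyl_eq_of_hasDerivAt hα hβ hβ0 hg hd hc hx1, mul_neg, neg_neg, ← integral_const_mul]
    have : ∀ u, K x u = (Ioi x).indicator
        (fun u => (x - s) ^ (-β) * (g' u * (u - x) ^ (β - 1))) u := by
      intro u
      by_cases h : x < u <;> simp [K, h]
      ring
    simp_rw [this]
    rw [integral_indicator measurableSet_Ioi, hμ, Measure.restrict_restrict measurableSet_Ioi]
    congr 2
    ext y
    simp only [mem_inter_iff, mem_Ioi, mem_Ioc]
    constructor
    · rintro ⟨h1, h2, h3⟩; exact ⟨h1, h3⟩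
    · rintro ⟨h1, h2⟩; exact ⟨h1, by linarith [hx.1], h2⟩
  have hR : ∫ u, ∫ x, K x u ∂μ ∂μ = Real.Gamma (1 - β) * Real.Gamma β * (g 1 - g s) := by
    rw [← intervalIntegral.integral_eq_sub_of_hasDerivAt (fun x _ => hd x)
      (hc.intervalIntegrable s 1), intervalIntegral.integral_of_le hs, ← integral_const_mul]
    refine integral_congr_ae ?_
    filter_upwards [self_mem_ae_restrict measurableSet_Ioc] with u hu
    simp only [K]
    rw [integral_mul_const, hrestr u hu, setIntegral_beta hβ0 hβ1 hu.1]
  rw [hL, hR] at hswap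
  linarith

/-- The average of `g` over `[x, x + ε]`. -/
def average (g : ℝ → ℝ) (ε x : ℝ) : ℝ := ∫ r in (0 : ℝ)..1, g (x + ε * r)

theorem hasDerivAt_average (hgc : Continuous g) {ε : ℝ} (hε : ε ≠ 0) (x : ℝ) :
    HasDerivAt (average g ε) (ε⁻¹ * (g (x + ε) - g x)) x := by
  have h : average g ε = fun x => ε⁻¹ * ((∫ y in (0 : ℝ)..(x + ε), g y) - ∫ y in (0 : ℝ)..x, g y) := by
    ext x
    rw [average, intervalIntegral.integral_comp_add_mul g hε,
      ← intervalIntegral.integral_interval_sub_left (a := 0) (hgc.intervalIntegrable _ _)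
        (hgc.intervalIntegrable _ _)]
    simp
  rw [h]
  refine HasDerivAt.const_mul _ (HasDerivAt.sub ?_ ?_)
  · simpa using (hgc.integral_hasStrictDerivAt 0 (x + ε)).hasDerivAt.comp_add_const x ε
  · exact (hgc.integral_hasStrictDerivAt 0 x).hasDerivAt

/-- Averaging makes `g` continuously differentiable without enlarging its Hölder constant, which
keeps all the bounds uniform in `ε`. -/
theorem abs_average_sub_le (hgc : Continuous g) (hg : ∀ s t, |g t - g s| ≤ C * |t - s| ^ α)
    (ε s t : ℝ) : |average g ε t - average g ε s| ≤ C * |t - s| ^ α := by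
  rw [average, average, ← intervalIntegral.integral_sub
    ((by fun_prop : Continuous fun r => g (t + ε * r)).intervalIntegrable _ _)
    ((by fun_prop : Continuous fun r => g (s + ε * r)).intervalIntegrable _ _)]
  have := intervalIntegral.norm_integral_le_of_norm_le_const (a := (0 : ℝ)) (b := 1)
    (f := fun r => g (t + ε * r) - g (s + ε * r)) (C := C * |t - s| ^ α) (fun r _ => by
      have := hg (s + ε * r) (t + ε * r)
      simpa using this)
  simpa using this

theorem tendsto_average (hα : 0 < α) (hg : ∀ s t, |g t - g s| ≤ C * |t - s| ^ α) {ε : ℕ → ℝ}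
    (hε : Tendsto ε atTop (𝓝 0)) (x : ℝ) :
    Tendsto (fun n => average g (ε n) x) atTop (𝓝 (g x)) := by
  have hgc := continuous_of_holder hα hg
  have hcont : Continuous fun e => average g e x := by
    unfold average
    exact intervalIntegral.continuous_parametric_intervalIntegral_of_continuous' (by fun_prop) 0 1
  have := (hcont.tendsto 0).comp hε
  simpa [average, Function.comp_def] using this

/-- The right-sided fractional integral inverts the right-sided Weyl derivative on Hölder
functions. -/
theorem integral_weyl (hα : 0 < α) (hβ : 1 - α < β) (hβ0 : 0 < β) (hβ1 : β < 1)
    (hg : ∀ s t, |g t - g s| ≤ C * |t - s| ^ α) {s : ℝ} (hs0 : 0 ≤ s) (hs : s ≤ 1) :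
    ∫ x in Ioc s 1, (x - s) ^ (-β) * weyl β g x =
      Real.Gamma (1 - β) * Real.Gamma β * (g s - g 1) := by
  have hgc := continuous_of_holder hα hg
  let ε : ℕ → ℝ := fun n => 1 / ((n : ℝ) + 1)
  have hε : Tendsto ε atTop (𝓝 0) := tendsto_one_div_add_atTop_nhds_zero_nat
  have hε0 : ∀ n, ε n ≠ 0 := fun n => (Nat.one_div_pos_of_nat).ne'
  let G : ℕ → ℝ → ℝ := fun n => average g (ε n)
  have hG : ∀ n, ∀ s t, |G n t - G n s| ≤ C * |t - s| ^ α := fun n => abs_average_sub_le hgc hg (ε n)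
  have hGc : ∀ n, Continuous (G n) := fun n => continuous_of_holder hα (hG n)
  have hGt : ∀ x, Tendsto (fun n => G n x) atTop (𝓝 (g x)) := tendsto_average hα hg hε
  have hint : ∀ n, ∫ x in Ioc s 1, (x - s) ^ (-β) * weyl β (G n) x =
      Real.Gamma (1 - β) * Real.Gamma β * (G n s - G n 1) := fun n =>
    integral_weyl_of_hasDerivAt hα hβ hβ0 hβ1 (hG n) (hasDerivAt_average hgc (hε0 n))
      (by fun_prop) hs
  -- Dominated convergence is applied twice, to the inner integral here and to the outer one in
  -- `hlim`; both majorants depend only on `C`, `α` and `β`.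
  have hweyl : ∀ x < 1, Tendsto (fun n => weyl β (G n) x) atTop (𝓝 (weyl β g x)) := by
    intro x hx
    refine Tendsto.add (((hGt x).sub (hGt 1)).div_const _) (Tendsto.const_mul _ ?_)
    refine tendsto_integral_of_dominated_convergence (fun u => C * (u - x) ^ (α + β - 2))
      (fun n => (integrableOn_weyl_integrand hα hβ (hG n) x).aestronglyMeasurable)
      ((integrableOn_sub_rpow_left (by linarith) x 1).const_mul C) (fun n => ?_) ?_
    · filter_upwards [self_mem_ae_restrict measurableSet_Ioc] with u hu
      exact abs_weyl_integrand_le (hG n) hu.1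
    · exact Eventually.of_forall fun u => ((hGt x).sub (hGt u)).div_const _
  have hlim : Tendsto (fun n => ∫ x in Ioc s 1, (x - s) ^ (-β) * weyl β (G n) x) atTop
      (𝓝 (∫ x in Ioc s 1, (x - s) ^ (-β) * weyl β g x)) := by
    have hne : ∀ᵐ x ∂(volume.restrict (Ioc s 1)), x ∉ ({1} : Set ℝ) :=
      ae_restrict_of_ae (measure_eq_zero_iff_ae_notMem.1 (measure_singleton (1 : ℝ)))
    refine tendsto_integral_of_dominated_convergence
      (fun x => (x - s) ^ (-β) * (C + (1 - β) * (C / (α + β - 1))))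
      (fun n => ?_) ((integrableOn_sub_rpow_left (by linarith) s 1).mul_const _) (fun n => ?_) ?_
    · have := measurable_weyl (β := β) (hGc n).measurable
      exact Measurable.aestronglyMeasurable (by fun_prop)
    · filter_upwards [self_mem_ae_restrict measurableSet_Ioc, hne] with x hx hx1
      have hp := Real.rpow_nonneg (sub_nonneg.2 hx.1.le) (-β)
      rw [norm_mul, Real.norm_of_nonneg hp]
      exact mul_le_mul_of_nonneg_left (abs_weyl_le hβ hβ1 (hG n)
        ⟨hs0.trans_lt hx.1, lt_of_le_of_ne hx.2 hx1⟩) hp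
    · filter_upwards [self_mem_ae_restrict measurableSet_Ioc, hne] with x hx hx1
      exact (hweyl x (lt_of_le_of_ne hx.2 hx1)).const_mul _
  simp_rw [hint] at hlim
  exact tendsto_nhds_unique hlim (((hGt s).sub (hGt 1)).const_mul _)

end Inversion

/-! ### The left-sided derivative of an indicator. -/

/-- The one-sided power kernel `(x - s)_+ ^ (-β)`. -/
def powKernel (β s x : ℝ) : ℝ := (Ioi s).indicator (fun x => (x - s) ^ (-β)) x

theorem integrableOn_powKernel {β : ℝ} (hβ1 : β < 1) {s : ℝ} (hs : 0 ≤ s) :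
    IntegrableOn (powKernel β s) (Ioc 0 1) := by
  rw [IntegrableOn, show powKernel β s = (Ioi s).indicator (fun x => (x - s) ^ (-β)) from rfl,
    integrable_indicator_iff measurableSet_Ioi, IntegrableOn,
    Measure.restrict_restrict measurableSet_Ioi, inter_comm, Ioc_inter_Ioi, sup_eq_right.2 hs]
  exact integrableOn_sub_rpow_left (by linarith) s 1

theorem powKernel_nonneg (β s x : ℝ) : 0 ≤ powKernel β s x :=
  indicator_nonneg (fun _ hx => Real.rpow_nonneg (sub_nonneg.2 (mem_Ioi.1 hx).le) _) x

theorem setIntegral_powKernel_mul (β : ℝ) {s : ℝ} (hs : 0 ≤ s) (h : ℝ → ℝ) :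
    ∫ x in Ioc 0 1, powKernel β s x * h x = ∫ x in Ioc s 1, (x - s) ^ (-β) * h x := by
  have : ∀ x, powKernel β s x * h x = (Ioi s).indicator (fun x => (x - s) ^ (-β) * h x) x := by
    intro x
    by_cases hx : s < x <;> simp [powKernel, hx]
  simp_rw [this]
  rw [integral_indicator measurableSet_Ioi, Measure.restrict_restrict measurableSet_Ioi,
    inter_comm, Ioc_inter_Ioi, sup_eq_right.2 hs]

/-- The indicator function of `(-∞, s)`. -/
abbrev below (s : ℝ) : ℝ → ℝ := (Iio s).indicator fun _ => 1

theorem measurable_below (s : ℝ) : Measurable (below s) :=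
  measurable_const.indicator measurableSet_Iio

section Below

variable {β s x : ℝ}

/-- Points `u ≤ x` see a jump only if `u < s < x`, and there the numerator is `-1`; the singularity
at `u = x` is thereby avoided. -/
theorem below_sub_eqOn (hx : x ≠ s) :
    EqOn (fun u => (below s x - below s u) / (x - u) ^ (β + 1))
      (fun u => (Iio s).indicator (fun u => -((Ioi s).indicator (fun _ => 1) x *
        (x - u) ^ (-(β + 1)))) u) (Ioc 0 x) := by
  intro u hu
  have hp : 0 ≤ x - u := sub_nonneg.2 hu.2
  rcases lt_or_gt_of_ne hx with h | h
  · have : u < s := hu.2.trans_lt h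
    simp [below, h, this, not_lt.2 h.le]
  · by_cases hus : u < s
    · simp only [below, indicator, mem_Iio, mem_Ioi, h, not_lt.2 h.le, hus, if_true, if_false]
      rw [Real.rpow_neg hp]
      ring
    · simp [below, not_lt.2 h.le, hus]

theorem integrableOn_rpow_Ioc_of_lt (hs : s < x) (r : ℝ) :
    IntegrableOn (fun u => (x - u) ^ r) (Icc 0 s) := by
  refine ContinuousOn.integrableOn_Icc ?_
  intro u hu
  exact ((by fun_prop : ContinuousAt (fun u => x - u) u).rpow_const
    (Or.inl (by linarith [hu.2]))).continuousWithinAt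

theorem setIntegral_rpow_Ioc_of_lt (hβ : 0 < β) (hs0 : 0 ≤ s) (hs : s < x) :
    ∫ u in Ioc 0 s, (x - u) ^ (-(β + 1)) = β⁻¹ * ((x - s) ^ (-β) - x ^ (-β)) := by
  rw [← intervalIntegral.integral_of_le hs0,
    intervalIntegral.integral_comp_sub_left (fun y => y ^ (-(β + 1))) x,
    integral_rpow (Or.inr ⟨by linarith, ?_⟩)]
  · rw [show -(β + 1) + 1 = -β by ring, sub_zero]
    field_simp
    ring
  · rw [uIcc_of_le (by linarith)]
    rintro ⟨h, -⟩
    linarith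

theorem Ioc_inter_Iio_subset : Ioc 0 x ∩ Iio s ⊆ Icc 0 s :=
  fun _ hu => ⟨hu.1.1.le, (mem_Iio.1 hu.2).le⟩

theorem integrableOn_below (hx : x ≠ s) :
    IntegrableOn (fun u => (below s x - below s u) / (x - u) ^ (β + 1)) (Ioc 0 x) := by
  rw [integrableOn_congr_fun (below_sub_eqOn hx) measurableSet_Ioc, IntegrableOn,
    integrable_indicator_iff measurableSet_Iio, IntegrableOn,
    Measure.restrict_restrict measurableSet_Iio, inter_comm]
  rcases lt_or_gt_of_ne hx with h | h
  · simp [not_lt.2 h.le]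
  · exact ((((integrableOn_rpow_Ioc_of_lt h _).mono_set
      Ioc_inter_Iio_subset).const_mul _).neg)

theorem setIntegral_below (hβ : 0 < β) (hs : 0 ≤ s) (hx : x ≠ s) :
    ∫ u in Ioc 0 x, (below s x - below s u) / (x - u) ^ (β + 1) =
      -(Ioi s).indicator (fun x => β⁻¹ * ((x - s) ^ (-β) - x ^ (-β))) x := by
  rw [setIntegral_congr_fun measurableSet_Ioc (below_sub_eqOn hx),
    integral_indicator measurableSet_Iio, Measure.restrict_restrict measurableSet_Iio, inter_comm]
  rcases lt_or_gt_of_ne hx with h | h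
  · simp [not_lt.2 h.le]
  · have e : Ioc 0 x ∩ Iio s = Ioo 0 s := by
      ext u
      simp only [mem_inter_iff, mem_Ioc, mem_Iio, mem_Ioo]
      exact ⟨fun hu => ⟨hu.1.1, hu.2⟩, fun hu => ⟨⟨hu.1, by linarith [hu.2]⟩, hu.2⟩⟩
    rw [e, ← integral_Ioc_eq_integral_Ioo, integral_neg, integral_const_mul,
      setIntegral_rpow_Ioc_of_lt hβ hs h]
    simp [h]

/-- Since `below s` is nonincreasing, the absolute value only flips the sign, and the explicit
signed integral applies. -/
theorem lintegral_below_le (hβ : 0 < β) (hs : 0 ≤ s) (hx0 : 0 < x) (hx : x ≠ s) :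
    ∫⁻ u in Ioc 0 x, ENNReal.ofReal (|below s x - below s u| / (x - u) ^ (β + 1)) ≤
      ENNReal.ofReal (β⁻¹ * powKernel β s x) := by
  have h1 : ∀ u ∈ Ioc 0 x, |below s x - below s u| / (x - u) ^ (β + 1) =
      -((below s x - below s u) / (x - u) ^ (β + 1)) := by
    intro u hu
    rw [← neg_div]
    congr 1
    apply abs_of_nonpos
    rcases lt_or_ge x s with h | h
    · simp [below, h, hu.2.trans_lt h]
    · simp only [below, indicator, mem_Iio, not_lt.2 h, if_false]
      split_ifs <;> norm_num
  have hint : Integrable (fun u => -((below s x - below s u) / (x - u) ^ (β + 1)))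
      (volume.restrict (Ioc 0 x)) := (integrableOn_below hx).neg
  rw [setLIntegral_congr_fun measurableSet_Ioc (fun u hu => by rw [h1 u hu]),
    ← ofReal_integral_eq_lintegral_ofReal hint]
  · refine ENNReal.ofReal_le_ofReal ?_
    rw [integral_neg, setIntegral_below hβ hs hx, neg_neg]
    by_cases h : s < x
    · simp only [indicator, mem_Ioi, h, if_true, powKernel]
      have := Real.rpow_nonneg hx0.le (-β)
      exact mul_le_mul_of_nonneg_left (by linarith) (inv_pos.2 hβ).le
    · simp [powKernel, h]
  · filter_upwards [self_mem_ae_restrict measurableSet_Ioc] with u hu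
    have := h1 u hu
    simp only [Pi.zero_apply]
    rw [← this]
    exact div_nonneg (abs_nonneg _) (Real.rpow_nonneg (sub_nonneg.2 hu.2) _)

/-- Left of the jump only `x ^ (-β)` is present; right of it the integral over `(0, s)` supplies
both kernels. -/
theorem below_div_add (hβ : 0 < β) (hs : 0 ≤ s) (hx0 : 0 < x) (hx : x ≠ s) :
    below s x / (x - 0) ^ β + β * ∫ u in Ioc 0 x, (below s x - below s u) / (x - u) ^ (β + 1) =
      powKernel β 0 x - powKernel β s x := by
  rw [setIntegral_below hβ hs hx]
  rcases lt_or_gt_of_ne hx with h | h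
  · simp [below, powKernel, h, hx0, not_lt.2 h.le, Real.rpow_neg hx0.le]
  · simp only [below, powKernel, indicator, mem_Iio, mem_Ioi, h, hx0, not_lt.2 h.le, if_true,
      if_false, sub_zero, zero_div, zero_add]
    field_simp
    ring

end Below

/-! ### The integral of a step function. -/

section Step

variable {ι : Type*} (A : Finset ι) (b s : ι → ℝ) {β : ℝ}

/-- The step function `∑ b i * 1_{(-∞, s i)}`. -/
def stepFun (t : ℝ) : ℝ := ∑ i ∈ A, b i * below (s i) t

theorem measurable_stepFun : Measurable (stepFun A b s) := by
  unfold stepFun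
  exact Finset.measurable_fun_sum _ fun i _ => (measurable_below (s i)).const_mul _

theorem ae_restrict_ne_finset :
    ∀ᵐ x ∂(volume.restrict (Ioc (0 : ℝ) 1)), ∀ i ∈ A, x ≠ s i := by
  rw [eventually_all_finset]
  intro i _
  exact ae_restrict_of_ae (measure_eq_zero_iff_ae_notMem.1 (measure_singleton (s i)))

theorem leftDeriv_stepFun (hβ : 0 < β) (hs : ∀ i ∈ A, 0 ≤ s i) {x : ℝ} (hx0 : 0 < x)
    (hx : ∀ i ∈ A, x ≠ s i) :
    leftDeriv β 0 (stepFun A b s) x = 1 / Real.Gamma (1 - β) *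
      ∑ i ∈ A, b i * (powKernel β 0 x - powKernel β (s i) x) := by
  have e : ∀ u, (stepFun A b s x - stepFun A b s u) / (x - u) ^ (β + 1) =
      ∑ i ∈ A, b i * ((below (s i) x - below (s i) u) / (x - u) ^ (β + 1)) := by
    intro u
    rw [stepFun, stepFun, ← Finset.sum_sub_distrib, Finset.sum_div]
    exact Finset.sum_congr rfl fun i _ => by ring
  rw [leftDeriv]
  simp_rw [e]
  rw [integral_finsetSum _ fun i hi => (integrableOn_below (hx i hi)).const_mul _, stepFun,
    Finset.sum_div, Finset.mul_sum, ← Finset.sum_add_distrib]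
  congr 1
  refine Finset.sum_congr rfl fun i hi => ?_
  rw [← below_div_add hβ (hs i hi) hx0 (hx i hi), integral_const_mul]
  ring

theorem fracNorm_stepFun_lt_top (hβ : 0 < β) (hβ1 : β < 1) (hs : ∀ i ∈ A, 0 ≤ s i) :
    fracNorm β 0 1 (stepFun A b s) < ∞ := by
  have hint : Integrable (fun x => ∑ i ∈ A, |b i| * (powKernel β 0 x + β⁻¹ * powKernel β (s i) x))
      (volume.restrict (Ioc (0 : ℝ) 1)) :=
    integrable_finsetSum _ fun i hi => ((integrableOn_powKernel hβ1 le_rfl).add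
      ((integrableOn_powKernel hβ1 (hs i hi)).const_mul _)).const_mul _
  refine lt_of_le_of_lt (lintegral_mono_ae ?_) hint.lintegral_lt_top
  filter_upwards [self_mem_ae_restrict measurableSet_Ioc, ae_restrict_ne_finset A s] with x hx hne
  have hnn : ∀ i, 0 ≤ |b i| := fun i => abs_nonneg _
  have hk := powKernel_nonneg β
  have h1 : |stepFun A b s x| / (x - 0) ^ β ≤ ∑ i ∈ A, |b i| * powKernel β 0 x := by
    have e : powKernel β 0 x = ((x - 0) ^ β)⁻¹ := by
      simp [powKernel, hx.1, Real.rpow_neg hx.1.le]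
    rw [div_eq_mul_inv, ← e, ← Finset.sum_mul]
    refine mul_le_mul_of_nonneg_right ?_ (hk 0 x)
    refine (Finset.abs_sum_le_sum_abs _ _).trans (Finset.sum_le_sum fun i _ => ?_)
    rw [abs_mul]
    refine mul_le_of_le_one_right (hnn i) ?_
    simp only [below, indicator]
    split_ifs <;> simp
  have h2 : ∫⁻ u in Ioc 0 x,
      ENNReal.ofReal (|stepFun A b s x - stepFun A b s u| / (x - u) ^ (β + 1)) ≤
      ENNReal.ofReal (∑ i ∈ A, |b i| * (β⁻¹ * powKernel β (s i) x)) := by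
    have hle : ∀ u ∈ Ioc 0 x,
        ENNReal.ofReal (|stepFun A b s x - stepFun A b s u| / (x - u) ^ (β + 1)) ≤
        ∑ i ∈ A, ENNReal.ofReal |b i| *
          ENNReal.ofReal (|below (s i) x - below (s i) u| / (x - u) ^ (β + 1)) := by
      intro u hu
      have hp := Real.rpow_nonneg (sub_nonneg.2 hu.2) (β + 1)
      simp_rw [← ENNReal.ofReal_mul (hnn _)]
      rw [← ENNReal.ofReal_sum_of_nonneg fun i _ =>
        mul_nonneg (hnn i) (div_nonneg (abs_nonneg _) hp)]
      refine ENNReal.ofReal_le_ofReal ?_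
      simp_rw [mul_div_assoc']
      rw [← Finset.sum_div]
      refine div_le_div_of_nonneg_right ?_ hp
      rw [stepFun, stepFun, ← Finset.sum_sub_distrib]
      refine (Finset.abs_sum_le_sum_abs _ _).trans (Finset.sum_le_sum fun i _ => ?_)
      rw [← mul_sub, abs_mul]
    refine (setLIntegral_mono' measurableSet_Ioc hle).trans ?_
    have hm : ∀ i, Measurable fun u =>
        ENNReal.ofReal (|below (s i) x - below (s i) u| / (x - u) ^ (β + 1)) := by
      intro i
      have := measurable_below (s i)
      fun_prop
    rw [lintegral_finsetSum _ fun i _ => (hm i).const_mul _, ENNReal.ofReal_sum_of_nonneg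
      fun i _ => mul_nonneg (hnn i) (mul_nonneg (inv_pos.2 hβ).le (hk _ _))]
    refine Finset.sum_le_sum fun i hi => ?_
    rw [lintegral_const_mul _ (hm i), ENNReal.ofReal_mul (hnn i)]
    gcongr
    exact lintegral_below_le hβ (hs i hi) hx.1 (hne i hi)
  refine (add_le_add (ENNReal.ofReal_le_ofReal h1) h2).trans ?_
  rw [← ENNReal.ofReal_add, ← Finset.sum_add_distrib]
  · simp_rw [mul_add]
    exact le_rfl
  · exact Finset.sum_nonneg fun i _ => mul_nonneg (hnn i) (hk _ _)
  · exact Finset.sum_nonneg fun i _ =>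
      mul_nonneg (hnn i) (mul_nonneg (inv_pos.2 hβ).le (hk _ _))

/-- The generalized Lebesgue-Stieltjes integral of a step function against a Hölder function is
the corresponding Riemann-Stieltjes sum. -/
theorem hasIntegral_stepFun {g : ℝ → ℝ} {α C : ℝ} (hα : 0 < α) (hβα : 1 - α < β) (hβ : 0 < β)
    (hβ1 : β < 1) (hg : ∀ s t, |g t - g s| ≤ C * |t - s| ^ α) (hs : ∀ i ∈ A, s i ∈ Icc (0 : ℝ) 1) :
    HasIntegral β 0 1 (stepFun A b s) g (∑ i ∈ A, b i * (g (s i) - g 0)) := by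
  have hs0 : ∀ i ∈ A, 0 ≤ s i := fun i hi => (hs i hi).1
  have hgm := (continuous_of_holder hα hg).measurable
  have hwm := measurable_weyl (β := β) hgm
  have hne1 : ∀ᵐ x ∂(volume.restrict (Ioc (0 : ℝ) 1)), x ∉ ({1} : Set ℝ) :=
    ae_restrict_of_ae (measure_eq_zero_iff_ae_notMem.1 (measure_singleton (1 : ℝ)))
  have hwb : ∀ᵐ x ∂(volume.restrict (Ioc (0 : ℝ) 1)),
      ‖weyl β g x‖ ≤ C + (1 - β) * (C / (α + β - 1)) := by
    filter_upwards [self_mem_ae_restrict measurableSet_Ioc, hne1] with x hx hx1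
    exact abs_weyl_le hβα hβ1 hg ⟨hx.1, lt_of_le_of_ne hx.2 hx1⟩
  have hleft : leftDeriv β 0 (stepFun A b s) =ᵐ[volume.restrict (Ioc (0 : ℝ) 1)] fun x =>
      1 / Real.Gamma (1 - β) * ∑ i ∈ A, b i * (powKernel β 0 x - powKernel β (s i) x) := by
    filter_upwards [self_mem_ae_restrict measurableSet_Ioc, ae_restrict_ne_finset A s] with x hx hne
    exact leftDeriv_stepFun A b s hβ hs0 hx.1 hne
  have hG1 : Real.Gamma (1 - β) ≠ 0 := (Real.Gamma_pos_of_pos (by linarith)).ne'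
  have hG2 : Real.Gamma β ≠ 0 := (Real.Gamma_pos_of_pos hβ).ne'
  refine ⟨⟨hβ, hβ1⟩, (measurable_stepFun A b s).aemeasurable,
    fracNorm_stepFun_lt_top A b s hβ hβ1 hs0, ?_,
    Eventually.of_forall (integrableOn_weyl_integrand hα hβα hg), ?_, ?_⟩
  · rw [memLp_one_iff_integrable]
    refine Integrable.congr ?_ hleft.symm
    exact (integrable_finsetSum _ fun i hi => ((integrableOn_powKernel hβ1 le_rfl).sub
      (integrableOn_powKernel hβ1 (hs0 i hi))).const_mul _).const_mul _
  · rw [funext (rightDeriv_eq_weyl β g)]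
    refine MemLp.const_mul ?_ _
    refine memLp_top_of_bound (by fun_prop) (C + (1 - β) * (C / (α + β - 1))) ?_
    filter_upwards [hwb] with x hx
    rwa [Complex.norm_real]
  · have hpow : ∀ r, 0 ≤ r → Integrable (fun x => powKernel β r x * weyl β g x)
        (volume.restrict (Ioc (0 : ℝ) 1)) := fun r hr =>
      (integrableOn_powKernel hβ1 hr).mul_bdd hwm.aestronglyMeasurable hwb
    have hpow2 : ∀ i ∈ A, Integrable (fun x => b i *
        (powKernel β 0 x * weyl β g x - powKernel β (s i) x * weyl β g x))
        (volume.restrict (Ioc (0 : ℝ) 1)) := fun i hi =>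
      ((hpow 0 le_rfl).sub (hpow (s i) (hs0 i hi))).const_mul (b i)
    -- The inversion formula is used at `0` and at `s i`; the terms `g 1` cancel in the difference
    -- of kernels.
    have hreal : ∫ x in Ioc 0 1, leftDeriv β 0 (stepFun A b s) x * weyl β g x =
        -(Real.Gamma β * ∑ i ∈ A, b i * (g (s i) - g 0)) := by
      have e : ∫ x in Ioc 0 1, leftDeriv β 0 (stepFun A b s) x * weyl β g x =
          ∫ x in Ioc 0 1, 1 / Real.Gamma (1 - β) * ∑ i ∈ A, b i *
            (powKernel β 0 x * weyl β g x - powKernel β (s i) x * weyl β g x) := by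
        refine integral_congr_ae ?_
        filter_upwards [hleft] with x hx
        rw [hx, mul_assoc, Finset.sum_mul]
        congr 1
        exact Finset.sum_congr rfl fun i _ => by ring
      rw [e, integral_const_mul, integral_finsetSum _ fun i hi =>
        hpow2 i hi, Finset.mul_sum,
        Finset.mul_sum, ← Finset.sum_neg_distrib]
      refine Finset.sum_congr rfl fun i hi => ?_
      rw [integral_const_mul, integral_sub (hpow 0 le_rfl) (hpow (s i) (hs0 i hi)),
        setIntegral_powKernel_mul β le_rfl, setIntegral_powKernel_mul β (hs0 i hi),
        integral_weyl hα hβα hβ hβ1 hg le_rfl zero_le_one,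
        integral_weyl hα hβα hβ hβ1 hg (hs0 i hi) (hs i hi).2]
      field_simp
      ring
    have e : ∀ x, (leftDeriv β 0 (stepFun A b s) x : ℂ) * rightDeriv β 1 (fun x => g x - g 1) x =
        Complex.exp (Complex.I * Real.pi * (1 - β)) / (Real.Gamma β : ℂ) *
          ((leftDeriv β 0 (stepFun A b s) x * weyl β g x : ℝ) : ℂ) := by
      intro x
      rw [rightDeriv_eq_weyl]
      push_cast
      ring
    simp_rw [e]
    -- The two phases multiply to `exp (π i) = -1`, which absorbs the minus sign of `hreal`.
    rw [integral_const_mul, integral_complex_ofReal, hreal, ← mul_assoc, mul_div_assoc',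
      ← Complex.exp_add, show Complex.I * Real.pi * β + Complex.I * Real.pi * (1 - β) =
        Real.pi * Complex.I by ring, Complex.exp_pi_mul_I]
    have hG2' : (Real.Gamma β : ℂ) ≠ 0 := Complex.ofReal_ne_zero.2 hG2
    push_cast
    field_simp

/-- Each interval is a difference of two half-lines, so the index set is doubled with opposite
coefficients and `g 0` drops out. -/
theorem hasIntegral_stepFun_sub {g : ℝ → ℝ} {α C : ℝ} (r : ι → ℝ) (hα : 0 < α)
    (hβα : 1 - α < β) (hβ : 0 < β) (hβ1 : β < 1) (hg : ∀ s t, |g t - g s| ≤ C * |t - s| ^ α)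
    (hs : ∀ i ∈ A, s i ∈ Icc (0 : ℝ) 1) (hr : ∀ i ∈ A, r i ∈ Icc (0 : ℝ) 1) :
    HasIntegral β 0 1 (fun t => ∑ i ∈ A, b i * (below (s i) t - below (r i) t)) g
      (∑ i ∈ A, b i * (g (s i) - g (r i))) := by
  convert! hasIntegral_stepFun (A.disjSum A) (Sum.elim b fun i => -b i) (Sum.elim s r)
    hα hβα hβ hβ1 hg ?_ using 1
  · ext t
    simp only [stepFun, Finset.sum_disjSum, Sum.elim_inl, Sum.elim_inr, ← Finset.sum_add_distrib]
    exact Finset.sum_congr rfl fun i _ => by ring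
  · simp only [Finset.sum_disjSum, Sum.elim_inl, Sum.elim_inr, ← Finset.sum_add_distrib]
    exact Finset.sum_congr rfl fun i _ => by ring
  · intro i hi
    rcases Finset.mem_disjSum.1 hi with ⟨j, hj, rfl⟩ | ⟨j, hj, rfl⟩
    · exact hs j hj
    · exact hr j hj

theorem HasIntegral.congr {a b J : ℝ} {f f' g : ℝ → ℝ} (h : HasIntegral β a b f g J)
    (hf : EqOn f f' (Ioc a b)) : HasIntegral β a b f' g J := by
  have hsub : ∀ t ∈ Ioc a b, ∀ u ∈ Ioc a t, f u = f' u := fun t ht u hu =>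
    hf ⟨hu.1, hu.2.trans ht.2⟩
  have hl : EqOn (leftDeriv β a f) (leftDeriv β a f') (Ioc a b) := by
    intro x hx
    simp only [leftDeriv, hf hx]
    rw [setIntegral_congr_fun measurableSet_Ioc fun u hu => by
      show (f' x - f u) / (x - u) ^ (β + 1) = (f' x - f' u) / (x - u) ^ (β + 1)
      rw [hsub x hx u hu]]
  have hlae := (ae_restrict_mem (μ := volume) measurableSet_Ioc).mono hl
  refine ⟨h.order_mem, h.aemeasurable.congr ((ae_restrict_mem measurableSet_Ioc).mono hf), ?_,
    h.left_memLp.ae_eq hlae, h.right_inner, h.right_memLp, ?_⟩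
  · refine lt_of_eq_of_lt ?_ h.fracNorm_lt_top
    refine setLIntegral_congr_fun measurableSet_Ioc fun t ht => ?_
    simp only [hf ht]
    rw [setLIntegral_congr_fun measurableSet_Ioc fun u hu => by
      show ENNReal.ofReal (|f' t - f' u| / (t - u) ^ (β + 1)) =
        ENNReal.ofReal (|f' t - f u| / (t - u) ^ (β + 1))
      rw [hsub t ht u hu]]
  · rw [h.value]
    congr 1
    exact setIntegral_congr_fun measurableSet_Ioc fun x hx => by simp only [hl hx]

end Step

end GLS

/-! ### The pathwise strategy, its gain and its stopping. -/

/-- Discrete version of `∫ 2 (y - y 0) dy = (y - y 0) ^ 2`, stopped when `|y - y 0|` reaches `l`. -/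
theorem sum_stopped_quadratic_ge (y : ℕ → ℝ) (m : ℕ) {c l e : ℝ} (hc : 0 ≤ c) (hl : 0 ≤ l)
    (hy : ∃ j ≤ m, l ≤ |y j - y 0|) (he : ∀ j < m, |y (j + 1) - y j| ≤ e) :
    c * l ^ 2 - c * (m * e ^ 2) ≤ ∑ j ∈ Finset.range m,
      (if ∀ i ≤ j, |y i - y 0| < l then 2 * c * (y j - y 0) else 0) * (y (j + 1) - y j) := by
  have hex : ∃ j, l ≤ |y j - y 0| := hy.imp fun _ h => h.2
  classical
  set J := Nat.find hex
  have hJ : l ≤ |y J - y 0| := Nat.find_spec hex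
  have hJm : J ≤ m := by
    obtain ⟨j, hj, h⟩ := hy
    exact (Nat.find_min' hex h).trans hj
  have hlt : ∀ j < J, ∀ i ≤ j, |y i - y 0| < l := fun j hj i hi =>
    not_le.1 (Nat.find_min hex (hi.trans_lt hj))
  have hrestrict : ∑ j ∈ Finset.range m,
      (if ∀ i ≤ j, |y i - y 0| < l then 2 * c * (y j - y 0) else 0) * (y (j + 1) - y j) =
      ∑ j ∈ Finset.range J, 2 * c * (y j - y 0) * (y (j + 1) - y j) := by
    rw [← Finset.sum_subset (Finset.range_subset_range.2 hJm)]
    · refine Finset.sum_congr rfl fun j hj => ?_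
      rw [if_pos (hlt j (Finset.mem_range.1 hj))]
    · intro j _ hj
      rw [if_neg, zero_mul]
      intro h
      exact absurd (h J (not_lt.1 fun h' => hj (Finset.mem_range.2 h'))) (not_lt.2 hJ)
  -- Telescoping of `2 a (b - a) = b ^ 2 - a ^ 2 - (b - a) ^ 2`, with `a` and `b` consecutive
  -- displacements.
  have htel : ∀ K, ∑ j ∈ Finset.range K, 2 * c * (y j - y 0) * (y (j + 1) - y j) =
      c * (y K - y 0) ^ 2 - c * ∑ j ∈ Finset.range K, (y (j + 1) - y j) ^ 2 := by
    intro K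
    induction K with
    | zero => simp
    | succ K ih => rw [Finset.sum_range_succ, Finset.sum_range_succ, ih]; ring
  rw [hrestrict, htel]
  have h1 : l ^ 2 ≤ (y J - y 0) ^ 2 := by
    rw [← sq_abs (y J - y 0)]
    exact pow_le_pow_left₀ hl hJ 2
  have h2 : ∑ j ∈ Finset.range J, (y (j + 1) - y j) ^ 2 ≤ m * e ^ 2 := by
    calc _ ≤ ∑ j ∈ Finset.range J, e ^ 2 := Finset.sum_le_sum fun j hj => by
          rw [← sq_abs]
          exact pow_le_pow_left₀ (abs_nonneg _) (he j ((Finset.mem_range.1 hj).trans_le hJm)) 2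
      _ = J * e ^ 2 := by simp
      _ ≤ _ := mul_le_mul_of_nonneg_right (Nat.cast_le.2 hJm) (sq_nonneg e)
  exact sub_le_sub (mul_le_mul_of_nonneg_left h1 hc) (mul_le_mul_of_nonneg_left h2 hc)

/-- The deterministic data of a piecewise constant trading strategy: consecutive blocks
`[node n, node (n + 1)]`, each divided into equal steps; inside a block the position is
proportional to the displacement of the path, until this displacement reaches `level n`. -/
structure StepStrategy where
  node : ℕ → ℝ
  steps : ℕ → ℕ
  weight : ℕ → ℝ
  level : ℕ → ℝ
  node_lt : ∀ n, node n < node (n + 1)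
  steps_pos : ∀ n, 0 < steps n

namespace StepStrategy

open GLS

variable (S : StepStrategy)

/-- The `j`-th grid point of the `n`-th block. -/
def pt (n j : ℕ) : ℝ := S.node n + j / S.steps n * (S.node (n + 1) - S.node n)

theorem node_strictMono : StrictMono S.node := strictMono_nat_of_lt_succ S.node_lt

theorem pt_zero (n : ℕ) : S.pt n 0 = S.node n := by simp [pt]

theorem pt_steps (n : ℕ) : S.pt n (S.steps n) = S.node (n + 1) := by
  have : (S.steps n : ℝ) ≠ 0 := Nat.cast_ne_zero.2 (S.steps_pos n).ne'
  simp [pt, this]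

theorem pt_mono (n : ℕ) : Monotone (S.pt n) := by
  intro i j hij
  have := (S.node_lt n).le
  unfold pt
  gcongr

theorem node_le_pt (n j : ℕ) : S.node n ≤ S.pt n j := S.pt_zero n ▸ S.pt_mono n (Nat.zero_le j)

theorem pt_le_node {n j : ℕ} (hj : j ≤ S.steps n) : S.pt n j ≤ S.node (n + 1) :=
  S.pt_steps n ▸ S.pt_mono n hj

theorem pt_succ_sub (n j : ℕ) :
    S.pt n (j + 1) - S.pt n j = (S.node (n + 1) - S.node n) / S.steps n := by
  simp only [pt]
  push_cast
  ring

open Classical in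
/-- The position held on the `j`-th step of the `n`-th block. -/
def coef (x : ℝ → ℝ) (n j : ℕ) : ℝ :=
  if ∀ i ≤ j, |x (S.pt n i) - x (S.pt n 0)| < S.level n then
    2 * S.weight n * (x (S.pt n j) - x (S.pt n 0)) else 0

/-- The gain of the strategy up to time `u` over the first `N` blocks. -/
def gain (x : ℝ → ℝ) (N : ℕ) (u : ℝ) : ℝ :=
  ∑ n ∈ Finset.range N, ∑ j ∈ Finset.range (S.steps n),
    S.coef x n j * (x (min u (S.pt n (j + 1))) - x (min u (S.pt n j)))

/-- The position at time `u`, over the first `N` blocks. -/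
def position (x : ℝ → ℝ) (N : ℕ) (u : ℝ) : ℝ :=
  ∑ n ∈ Finset.range N, ∑ j ∈ Finset.range (S.steps n),
    S.coef x n j * (below (S.pt n (j + 1)) u - below (S.pt n j) u)

/-- Blocks starting after `u` have both endpoints truncated to `u`. Hence the gain before time `1`
does not depend on how many further blocks are included. -/
theorem gain_eq_of_le (x : ℝ → ℝ) {N M : ℕ} (hNM : N ≤ M) {u : ℝ} (hu : u ≤ S.node N) :
    S.gain x M u = S.gain x N u := by
  refine (Finset.sum_subset (Finset.range_subset_range.2 hNM) fun n _ hn => ?_).symm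
  refine Finset.sum_eq_zero fun j _ => ?_
  have h : ∀ j, u ≤ S.pt n j := fun j => hu.trans ((S.node_strictMono.monotone
    (not_lt.1 fun h => hn (Finset.mem_range.2 h))).trans (S.node_le_pt n j))
  rw [min_eq_left (h _), min_eq_left (h _), sub_self, mul_zero]

theorem position_eq_of_lt (x : ℝ → ℝ) {N M : ℕ} (hNM : N ≤ M) {u : ℝ} (hu : u < S.node N) :
    S.position x M u = S.position x N u := by
  refine (Finset.sum_subset (Finset.range_subset_range.2 hNM) fun n _ hn => ?_).symm
  refine Finset.sum_eq_zero fun j _ => ?_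
  have h : ∀ j, u < S.pt n j := fun j => hu.trans_le ((S.node_strictMono.monotone
    (not_lt.1 fun h => hn (Finset.mem_range.2 h))).trans (S.node_le_pt n j))
  simp [below, h]

theorem gain_of_le_node_zero (x : ℝ → ℝ) (N : ℕ) {u : ℝ} (hu : u ≤ S.node 0) :
    S.gain x N u = 0 := by
  rw [S.gain_eq_of_le x (Nat.zero_le N) hu]
  simp [gain]

theorem position_of_lt_node_zero (x : ℝ → ℝ) (N : ℕ) {u : ℝ} (hu : u < S.node 0) :
    S.position x N u = 0 := by
  rw [S.position_eq_of_lt x (Nat.zero_le N) hu]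
  simp [position]

theorem continuous_gain {x : ℝ → ℝ} (hx : Continuous x) (N : ℕ) : Continuous (S.gain x N) := by
  unfold gain
  fun_prop

theorem gain_node (x : ℝ → ℝ) (M : ℕ) :
    S.gain x M (S.node M) = ∑ n ∈ Finset.range M, ∑ j ∈ Finset.range (S.steps n),
      S.coef x n j * (x (S.pt n (j + 1)) - x (S.pt n j)) := by
  refine Finset.sum_congr rfl fun n hn => Finset.sum_congr rfl fun j hj => ?_
  have hj := Finset.mem_range.1 hj
  have h : ∀ i ≤ S.steps n, S.pt n i ≤ S.node M := fun i hi => (S.pt_le_node hi).trans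
    (S.node_strictMono.monotone (Finset.mem_range.1 hn))
  rw [min_eq_right (h _ hj), min_eq_right (h _ hj.le)]

theorem tendsto_gain_node (x : ℝ → ℝ) (h : ∀ᶠ n in atTop, (1 : ℝ) / 2 ≤
      ∑ j ∈ Finset.range (S.steps n), S.coef x n j * (x (S.pt n (j + 1)) - x (S.pt n j))) :
    Tendsto (fun M => S.gain x M (S.node M)) atTop atTop := by
  obtain ⟨N, hN⟩ := eventually_atTop.1 h
  set B : ℕ → ℝ := fun n =>
    ∑ j ∈ Finset.range (S.steps n), S.coef x n j * (x (S.pt n (j + 1)) - x (S.pt n j)) with hB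
  have hlow : ∀ k, ∑ n ∈ Finset.range N, B n + k * (1 / 2 : ℝ) ≤
      ∑ n ∈ Finset.range (k + N), B n := by
    intro k
    induction k with
    | zero => simp
    | succ k ih =>
      rw [show k + 1 + N = k + N + 1 by ring, Finset.sum_range_succ]
      have := hN (k + N) (by lia)
      push_cast
      linarith
  rw [← tendsto_add_atTop_iff_nat N]
  simp_rw [S.gain_node]
  refine tendsto_atTop_mono hlow (tendsto_atTop_add_const_left _ _ ?_)
  exact tendsto_natCast_atTop_atTop.atTop_mul_const (by norm_num)

/-- A number of blocks that suffices up to time `u`, if `u` lies before some node. -/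
def horizon (u : ℝ) : ℕ := sInf {n | u < S.node n}

theorem lt_node_horizon {u : ℝ} {M : ℕ} (h : u < S.node M) : u < S.node (S.horizon u) :=
  Nat.sInf_mem (s := {n | u < S.node n}) ⟨M, h⟩

theorem horizon_le {u : ℝ} {M : ℕ} (h : u < S.node M) : S.horizon u ≤ M := Nat.sInf_le h

/-- The gain has stayed away from `R` up to time `u`, expressed through countably many times. -/
def Running (x : ℝ → ℝ) (R u : ℝ) : Prop :=
  ∃ k : ℕ, ∀ q : ℚ,
    S.gain x (S.horizon u) (min u (max (S.node 0) q)) ≤ R - 1 / ((k : ℝ) + 1)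

open Classical in
/-- The position at time `u` of the strategy stopped when the gain reaches `R`. -/
def stopped (x : ℝ → ℝ) (R u : ℝ) : ℝ :=
  if S.Running x R u then S.position x (S.horizon u) u else 0

/-- Rational times suffice by continuity, and compactness of `[node 0, u]` turns the strict
inequality into a uniform gap `1 / (k + 1)`. The countable form is what makes the stopping rule
measurable. -/
theorem running_iff {x : ℝ → ℝ} (hx : Continuous x) {R u : ℝ} (hu : S.node 0 ≤ u) :
    S.Running x R u ↔ ∀ w ∈ Icc (S.node 0) u, S.gain x (S.horizon u) w < R := by
  have hc := S.continuous_gain hx (S.horizon u)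
  constructor
  · rintro ⟨k, hk⟩ w hw
    have hcl : IsClosed {y : ℝ | S.gain x (S.horizon u) (min u (max (S.node 0) y)) ≤
        R - 1 / ((k : ℝ) + 1)} := isClosed_le (by fun_prop) continuous_const
    have := Rat.denseRange_cast (𝕜 := ℝ) |>.induction_on (p := fun y =>
      S.gain x (S.horizon u) (min u (max (S.node 0) y)) ≤ R - 1 / ((k : ℝ) + 1)) w hcl hk
    rw [max_eq_right hw.1, min_eq_right hw.2] at this
    have h2 : (0 : ℝ) < 1 / ((k : ℝ) + 1) := Nat.one_div_pos_of_nat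
    linarith
  · intro h
    obtain ⟨w, hw, hmax⟩ := isCompact_Icc.exists_isMaxOn (nonempty_Icc.2 hu) hc.continuousOn
    obtain ⟨k, hk⟩ := exists_nat_one_div_lt (sub_pos.2 (h w hw))
    refine ⟨k, fun q => ?_⟩
    have : S.gain x (S.horizon u) (min u (max (S.node 0) q)) ≤ S.gain x (S.horizon u) w :=
      hmax ⟨le_min hu (le_max_left _ _), min_le_left _ _⟩
    linarith

/-- `τ` is the first time the gain is at least `R`; continuity gives equality there. Cutting the
position off at `τ` amounts to replacing every grid point `p` by `min τ p`. -/
theorem exists_stopping_time {x : ℝ → ℝ} (hx : Continuous x) {R : ℝ} (hR : 0 ≤ R) {M : ℕ}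
    (hM : R ≤ S.gain x M (S.node M)) :
    ∃ τ ∈ Icc (S.node 0) (S.node M), S.gain x M τ = R ∧
      ∀ u, S.stopped x R u = ∑ n ∈ Finset.range M, ∑ j ∈ Finset.range (S.steps n),
        S.coef x n j * (below (min τ (S.pt n (j + 1))) u - below (min τ (S.pt n j)) u) := by
  have hc := S.continuous_gain hx M
  have h0M : S.node 0 ≤ S.node M := S.node_strictMono.monotone (Nat.zero_le M)
  set T := Icc (S.node 0) (S.node M) ∩ {u | R ≤ S.gain x M u}
  have hTc : IsCompact T := isCompact_Icc.inter_right (isClosed_le continuous_const hc)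
  obtain ⟨τ, ⟨hτ, hτR⟩, hmin⟩ := hTc.exists_isLeast ⟨_, right_mem_Icc.2 h0M, hM⟩
  have hbefore : ∀ u ∈ Ico (S.node 0) τ, S.gain x M u < R := fun u hu =>
    not_le.1 fun h => absurd (hmin ⟨⟨hu.1, hu.2.le.trans hτ.2⟩, h⟩) (not_le.2 hu.2)
  have hτeq : S.gain x M τ = R := by
    refine le_antisymm ?_ hτR
    rcases hτ.1.eq_or_lt with h | h
    · rw [S.gain_of_le_node_zero x M h.ge]
      exact hR
    · have hcl : IsClosed {u | S.gain x M u ≤ R} := isClosed_le hc continuous_const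
      have : τ ∈ closure (Ico (S.node 0) τ) := by
        rw [closure_Ico h.ne]
        exact right_mem_Icc.2 h.le
      exact hcl.closure_subset_iff.2 (fun u hu => (hbefore u hu).le) this
  refine ⟨τ, hτ, hτeq, fun u => ?_⟩
  have hbelow : ∀ p, below (min τ p) u = if u < τ then below p u else 0 := by
    intro p
    by_cases h : u < τ <;> simp [below, indicator, h]
  simp_rw [hbelow]
  rcases lt_or_ge u τ with h | h
  · simp only [h, if_true]
    have huM := h.trans_le hτ.2
    have hpos : S.position x M u = S.position x (S.horizon u) u :=
      S.position_eq_of_lt x (S.horizon_le huM) (S.lt_node_horizon huM)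
    change _ = S.position x M u
    rcases lt_or_ge u (S.node 0) with h0 | h0
    · rw [stopped, S.position_of_lt_node_zero x _ h0, S.position_of_lt_node_zero x _ h0, ite_self]
    · rw [stopped, if_pos, hpos]
      rw [S.running_iff hx h0]
      intro w hw
      rw [← S.gain_eq_of_le x (S.horizon_le huM) (hw.2.trans (S.lt_node_horizon huM).le)]
      exact hbefore w ⟨hw.1, hw.2.trans_lt h⟩
  · simp only [not_lt.2 h, if_false, sub_self, mul_zero, Finset.sum_const_zero]
    by_cases hex : ∃ N, u < S.node N
    · obtain ⟨N, hN⟩ := hex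
      rw [stopped, if_neg]
      rw [S.running_iff hx (hτ.1.trans h)]
      intro hrun
      have h1 := hrun τ ⟨hτ.1, h⟩
      have hu := S.lt_node_horizon hN
      rw [← S.gain_eq_of_le x (le_max_left _ M) (h.trans hu.le),
        S.gain_eq_of_le x (le_max_right _ M) hτ.2, hτeq] at h1
      exact lt_irrefl _ h1
    -- With no node beyond `u`, the infimum of the empty set is `0`, so the position is an empty
    -- sum, as required after `τ`.
    · have : S.horizon u = 0 := by
        have : {n | u < S.node n} = ∅ := by
          ext n
          simpa using fun h => hex ⟨n, h⟩
        rw [horizon, this, Nat.sInf_empty]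
      simp [stopped, position, this]

end StepStrategy

/-! ### Tuning the blocks so that each eventually earns `1 / 2`. -/

theorem exists_steps {α D w l K : ℝ} (hα : 1 / 2 < α) (hD : 0 < D) (hl : 0 < l) :
    ∃ m : ℕ, 0 < m ∧ w * (m * ((D / m) ^ α) ^ 2) * K ≤ 1 ∧ (D / m) ^ α * K ≤ l := by
  have hm : Tendsto (fun m : ℕ => D / (m : ℝ)) atTop (𝓝 0) := tendsto_const_div_atTop_nhds_zero_nat D
  have h2 : Tendsto (fun m : ℕ => (D / (m : ℝ)) ^ α * K) atTop (𝓝 0) := by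
    have := (hm.rpow_const (p := α) (Or.inr (by linarith))).mul_const K
    simpa [Real.zero_rpow (by linarith : α ≠ 0)] using this
  have h1 : Tendsto (fun m : ℕ => w * ((m : ℝ) * ((D / m) ^ α) ^ 2) * K) atTop (𝓝 0) := by
    -- `m * (D / m) ^ (2 α) = D * (D / m) ^ (2 α - 1)` tends to `0` exactly because `α > 1 / 2`.
    have h3 := (hm.rpow_const (p := 2 * α - 1) (Or.inr (by linarith)))
    rw [Real.zero_rpow (by linarith)] at h3
    have h4 := ((h3.const_mul D).const_mul w).mul_const K
    simp only [mul_zero, zero_mul] at h4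
    refine h4.congr' ?_
    filter_upwards [eventually_gt_atTop 0] with m hm0
    have hm' : (0 : ℝ) < m := Nat.cast_pos.2 hm0
    have hd : 0 < D / m := div_pos hD hm'
    have e : ((D / (m : ℝ)) ^ α) ^ 2 = (D / m) ^ (2 * α - 1) * (D / m) := by
      rw [← Real.rpow_natCast, ← Real.rpow_mul hd.le]
      nth_rewrite 3 [← Real.rpow_one (D / m)]
      rw [← Real.rpow_add hd]
      congr 1
      push_cast
      ring
    rw [e]
    field_simp
  obtain ⟨m, ha, hb, hc⟩ := ((eventually_gt_atTop 0).and
    ((h1.eventually_le_const zero_lt_one).and (h2.eventually_le_const hl))).exists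
  exact ⟨m, ha, hb, hc⟩

namespace StepStrategy

/-- The quantitative relations between levels, weights and meshes which make the gain of every
block eventually at least `1 / 2`. -/
structure IsTuned (S : StepStrategy) (α v : ℝ) : Prop where
  node_zero : S.node 0 = v
  node_lt_one : ∀ n, S.node n < 1
  level_pos : ∀ n, 0 < S.level n
  level_eq : ∀ n : ℕ, 2 * S.level n = ((S.node (n + 1) - S.node n) / (n + 1)) ^ α
  weight_eq : ∀ n, S.weight n = 1 / S.level n ^ 2
  error_le : ∀ n : ℕ, S.weight n * (S.steps n *
    (((S.node (n + 1) - S.node n) / S.steps n) ^ α) ^ 2) * (n + 1) ≤ 1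
  mesh_le : ∀ n : ℕ, ((S.node (n + 1) - S.node n) / S.steps n) ^ α * (n + 1) ≤ S.level n

theorem exists_isTuned {α v : ℝ} (hα : 1 / 2 < α) (hv : v < 1) :
    ∃ S : StepStrategy, S.IsTuned α v := by
  -- The nodes start at `v` and increase strictly to `1`.
  let t : ℕ → ℝ := fun n => 1 - (1 - v) / ((n : ℝ) + 1)
  have hv' : 0 < 1 - v := sub_pos.2 hv
  have ht : ∀ n, t n < t (n + 1) := by
    intro n
    have : (0 : ℝ) < (n : ℝ) + 1 := by positivity
    simp only [t]
    push_cast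
    gcongr
    linarith
  let l : ℕ → ℝ := fun n => ((t (n + 1) - t n) / (n + 1)) ^ α / 2
  have hd : ∀ n, 0 < t (n + 1) - t n := fun n => sub_pos.2 (ht n)
  have hl : ∀ n, 0 < l n := fun n =>
    half_pos (Real.rpow_pos_of_pos (div_pos (hd n) (by positivity)) _)
  choose m hm0 hm1 hm2 using fun n : ℕ =>
    exists_steps (w := 1 / l n ^ 2) (K := (n : ℝ) + 1) hα (hd n) (hl n)
  refine ⟨⟨t, m, fun n => 1 / l n ^ 2, l, ht, hm0⟩, ?_, ?_, hl, ?_, fun _ => rfl, hm1, hm2⟩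
  · simp [t]
  · intro n
    simp only [t]
    have : 0 < (1 - v) / ((n : ℝ) + 1) := by positivity
    linarith
  · intro n
    simp only [l]
    ring

variable {S : StepStrategy} {α v : ℝ}

theorem IsTuned.eventually_block_gain (hS : S.IsTuned α v) {x : ℝ → ℝ} {C : ℝ}
    (hx : ∀ s t, |x t - x s| ≤ C * |t - s| ^ α)
    (hex : ∀ᶠ n in atTop, ∃ u ∈ Icc (S.node n) (S.node (n + 1)),
      2 * S.level n < |x u - x (S.node n)|) (hα : 0 < α) :
    ∀ᶠ n in atTop, (1 : ℝ) / 2 ≤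
      ∑ j ∈ Finset.range (S.steps n), S.coef x n j * (x (S.pt n (j + 1)) - x (S.pt n j)) := by
  have hC : 0 ≤ C := by simpa using (abs_nonneg _).trans (hx 0 1)
  -- The strategy cannot depend on the random constant `C`; the factors `n + 1` in `error_le` and
  -- `mesh_le` dominate it from some block on.
  have hlarge : ∀ᶠ n : ℕ in atTop, max C (2 * C ^ 2) ≤ n :=
    tendsto_natCast_atTop_atTop.eventually_ge_atTop _
  filter_upwards [hex, hlarge] with n hn hnC
  obtain ⟨u, hu, hul⟩ := hn
  have hn1 : C ≤ (n : ℝ) + 1 := by linarith [le_max_left C (2 * C ^ 2)]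
  have hn2 : 2 * C ^ 2 ≤ (n : ℝ) + 1 := by linarith [le_max_right C (2 * C ^ 2)]
  have hm : (0 : ℝ) < S.steps n := Nat.cast_pos.2 (S.steps_pos n)
  have hD : 0 < S.node (n + 1) - S.node n := sub_pos.2 (S.node_lt n)
  set h := (S.node (n + 1) - S.node n) / S.steps n with hh
  have hpos : 0 < h := div_pos hD hm
  have hha : 0 ≤ h ^ α := (Real.rpow_pos_of_pos hpos α).le
  have hl := hS.level_pos n
  have hCl : C * h ^ α ≤ S.level n :=
    (by nlinarith : C * h ^ α ≤ h ^ α * (n + 1)).trans (hS.mesh_le n)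
  have hreach : ∃ j ≤ S.steps n, S.level n ≤ |x (S.pt n j) - x (S.pt n 0)| := by
    -- The exit time is rounded down to the grid. This moves the path by at most `level n`, so of
    -- the displacement `2 * level n` at least `level n` survives.
    set r := (u - S.node n) / h with hr
    have hr0 : 0 ≤ r := div_nonneg (sub_nonneg.2 hu.1) hpos.le
    have hu' : u = S.node n + r * h := by rw [hr]; field_simp; ring
    have hp : S.pt n ⌊r⌋₊ = S.node n + ⌊r⌋₊ * h := by rw [pt, hh]; ring
    have hfl := Nat.floor_le hr0
    have hfl2 := Nat.lt_floor_add_one r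
    refine ⟨⌊r⌋₊, ?_, ?_⟩
    · refine Nat.floor_le_of_le ?_
      rw [hr, div_le_iff₀ hpos, hh, mul_div_cancel₀ _ hm.ne']
      linarith [hu.2]
    · have hdist : |u - S.pt n ⌊r⌋₊| ≤ h := by
        rw [hp, hu', abs_le]
        constructor <;> nlinarith
      have h1 : |x u - x (S.pt n ⌊r⌋₊)| ≤ S.level n :=
        (hx _ _).trans ((mul_le_mul_of_nonneg_left
          (Real.rpow_le_rpow (abs_nonneg _) hdist hα.le) hC).trans hCl)
      rw [S.pt_zero]
      have h2 := abs_sub_le (x u) (x (S.pt n ⌊r⌋₊)) (x (S.node n))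
      linarith
  have hstep : ∀ j < S.steps n, |x (S.pt n (j + 1)) - x (S.pt n j)| ≤ C * h ^ α := by
    intro j _
    have := hx (S.pt n j) (S.pt n (j + 1))
    rwa [S.pt_succ_sub, abs_of_pos hpos] at this
  have hw : 0 ≤ S.weight n := by rw [hS.weight_eq]; positivity
  have key := sum_stopped_quadratic_ge (fun j => x (S.pt n j)) (S.steps n) hw hl.le hreach hstep
  have hone : S.weight n * S.level n ^ 2 = 1 := by
    rw [hS.weight_eq]
    field_simp
  have herr : S.weight n * (S.steps n * (C * h ^ α) ^ 2) ≤ 1 / 2 := by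
    have h1 := hS.error_le n
    rw [← hh] at h1
    have h2 : 0 ≤ S.weight n * (S.steps n * (h ^ α) ^ 2) := by positivity
    have e : S.weight n * (S.steps n * (C * h ^ α) ^ 2) =
        C ^ 2 * (S.weight n * (S.steps n * (h ^ α) ^ 2)) := by ring
    rw [e]
    nlinarith
  rw [hone] at key
  refine le_trans (by linarith) (key.trans (le_of_eq ?_))
  refine Finset.sum_congr rfl fun j _ => ?_
  simp only [coef]

end StepStrategy

/-! ### Quantile functions and the probability integral transform. -/

section Quantile

/-- The quantile function of `F`, set to `0` outside `(0, 1)`. -/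
def quantile (F : ℝ → ℝ) (y : ℝ) : ℝ := (Ioo (0 : ℝ) 1).indicator (fun y => sInf {x | y ≤ F x}) y

variable {F : ℝ → ℝ}

/-- Right-continuity ensures that the infimum belongs to the set; the limits of `F` make the set
nonempty and bounded below. -/
theorem quantile_le_iff (hF : IsDistributionFunction F) {y : ℝ} (hy : y ∈ Ioo (0 : ℝ) 1) (x : ℝ) :
    quantile F y ≤ x ↔ y ≤ F x := by
  rw [quantile, indicator_of_mem hy]
  have hne : {x | y ≤ F x}.Nonempty :=
    (hF.tendsto_atTop.eventually_const_le hy.2).exists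
  obtain ⟨z, hz⟩ := (hF.tendsto_atBot.eventually_lt_const hy.1).exists
  have hbdd : BddBelow {x | y ≤ F x} := ⟨z, fun w hw => by
    by_contra h
    exact absurd (hF.mono (not_le.1 h).le) (not_le.2 (hz.trans_le hw))⟩
  refine ⟨fun h => ?_, fun h => csInf_le hbdd h⟩
  have hgt : ∀ w ∈ Ioi x, y ≤ F w := by
    intro w hw
    obtain ⟨a, ha, haw⟩ := exists_lt_of_csInf_lt hne (h.trans_lt hw)
    exact (ha : y ≤ F a).trans (hF.mono haw.le)
  have hlim : Tendsto F (𝓝[>] x) (𝓝 (F x)) :=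
    (hF.right_cont x).mono_left (nhdsWithin_mono _ Ioi_subset_Ici_self)
  exact ge_of_tendsto hlim (eventually_nhdsWithin_of_forall hgt)

theorem measurable_quantile (hF : IsDistributionFunction F) : Measurable (quantile F) := by
  refine measurable_of_Iic fun x => ?_
  have : quantile F ⁻¹' Iic x = (Ioo 0 1 ∩ Iic (F x)) ∪ ((Ioo 0 1)ᶜ ∩ {_y | 0 ≤ x}) := by
    ext y
    by_cases hy : y ∈ Ioo (0 : ℝ) 1
    · have := quantile_le_iff hF hy x
      simp only [mem_preimage, mem_Iic, this, mem_union, mem_inter_iff, hy, true_and, mem_compl_iff,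
        not_true_eq_false, false_and, or_false]
    · have : quantile F y = 0 := indicator_of_notMem hy _
      simp only [mem_preimage, mem_Iic, this, mem_union, mem_inter_iff, hy, false_and,
        mem_compl_iff, not_false_eq_true, true_and, false_or, mem_ofPred_eq]
  rw [this]
  exact (measurableSet_Ioo.inter measurableSet_Iic).union
    (measurableSet_Ioo.compl.inter (MeasurableSet.const _))

theorem exists_cdf_eq {μ : Measure ℝ} (hc : Continuous (cdf μ)) {y : ℝ} (hy : y ∈ Ioo (0 : ℝ) 1) :
    ∃ z, cdf μ z = y := by
  obtain ⟨a, ha⟩ := ((tendsto_cdf_atBot μ).eventually_lt_const hy.1).exists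
  obtain ⟨b, hb⟩ := ((tendsto_cdf_atTop μ).eventually_const_lt hy.2).exists
  exact mem_range_of_exists_le_of_exists_ge hc ⟨a, ha.le⟩ ⟨b, hb.le⟩

/-- The probability integral transform. -/
theorem measureReal_cdf_le {μ : Measure ℝ} [IsProbabilityMeasure μ] (hc : Continuous (cdf μ))
    {y : ℝ} (hy : y ∈ Icc (0 : ℝ) 1) : μ.real {w | cdf μ w ≤ y} = y := by
  refine le_antisymm ?_ ?_
  · refine le_of_forall_gt_imp_ge_of_dense fun y' hy' => ?_
    rcases lt_or_ge y' 1 with h1 | h1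
    · obtain ⟨z, hz⟩ := exists_cdf_eq hc ⟨hy.1.trans_lt hy', h1⟩
      rw [← hz, cdf_eq_real]
      refine measureReal_mono fun w hw => ?_
      by_contra h
      exact absurd (monotone_cdf μ (not_le.1 h).le) (by rw [hz]; exact not_le.2 (lt_of_le_of_lt hw hy'))
    · exact measureReal_le_one.trans h1
  · refine le_of_forall_lt_imp_le_of_dense fun y' hy' => ?_
    rcases le_or_gt y' 0 with h0 | h0
    · exact h0.trans measureReal_nonneg
    · obtain ⟨z, hz⟩ := exists_cdf_eq hc ⟨h0, hy'.trans_le hy.2⟩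
      rw [← hz, cdf_eq_real]
      refine measureReal_mono fun w hw => ?_
      exact (monotone_cdf μ hw).trans (hz.le.trans hy'.le)

theorem IsDistributionFunction.mem_Icc (hF : IsDistributionFunction F) (x : ℝ) :
    F x ∈ Icc (0 : ℝ) 1 :=
  ⟨hF.mono.le_of_tendsto hF.tendsto_atBot x, hF.mono.ge_of_tendsto hF.tendsto_atTop x⟩

theorem cdf_map_quantile (hF : IsDistributionFunction F) {μ : Measure ℝ} [IsProbabilityMeasure μ]
    (hc : Continuous (cdf μ)) (x : ℝ) :
    cdf (μ.map fun w => quantile F (cdf μ w)) x = F x := by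
  have hm : Measurable fun w => quantile F (cdf μ w) :=
    (measurable_quantile hF).comp (monotone_cdf μ).measurable
  have := Measure.isProbabilityMeasure_map (μ := μ) hm.aemeasurable
  -- The Galois relation for `quantile` needs arguments in `(0, 1)`, so the values `0` and `1` of
  -- the cdf must be null.
  have h0 : ∀ᵐ w ∂μ, 0 < cdf μ w := by
    have h := measureReal_cdf_le hc (left_mem_Icc.2 zero_le_one)
    rw [measureReal_eq_zero_iff] at h
    simpa [ae_iff] using h
  have h1 : ∀ᵐ w ∂μ, cdf μ w < 1 := by
    have h : ∀ y ∈ Ioo (0 : ℝ) 1, μ.real {w | 1 ≤ cdf μ w} ≤ 1 - y := by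
      intro y hy
      have hms : MeasurableSet {w | cdf μ w ≤ y} := (monotone_cdf μ).measurable measurableSet_Iic
      rw [← measureReal_cdf_le hc (Ioo_subset_Icc_self hy), ← probReal_compl_eq_one_sub hms]
      refine measureReal_mono fun w hw => ?_
      simp only [mem_compl_iff, mem_ofPred_eq, not_le] at hw ⊢
      exact hy.2.trans_le hw
    have h2 : μ.real {w | 1 ≤ cdf μ w} ≤ 0 := by
      refine le_of_forall_gt_imp_ge_of_dense fun e he => ?_
      rcases lt_or_ge e 1 with h1 | h1
      · simpa using h (1 - e) ⟨by linarith, by linarith⟩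
      · exact measureReal_le_one.trans h1
    have h3 := (measureReal_eq_zero_iff (by finiteness)).1 (h2.antisymm measureReal_nonneg)
    simpa [ae_iff] using h3
  rw [cdf_eq_real, map_measureReal_apply hm measurableSet_Iic, ← measureReal_cdf_le hc (hF.mem_Icc x)]
  refine measureReal_congr ?_
  filter_upwards [h0, h1] with w hw0 hw1
  exact propext (quantile_le_iff hF ⟨hw0, hw1⟩ x)

end Quantile

/-! ### Adaptedness of the strategy, and exits by Borel-Cantelli. -/

section Paths

variable {Ω : Type*} {X : I → Ω → ℝ}

theorem extendPath_holder {α C : ℝ} (hα : 0 < α) (hC : 0 < C) {ω : Ω}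
    (h : ∀ s t : I, |X t ω - X s ω| ≤ C * |(t : ℝ) - s| ^ α) (s t : ℝ) :
    |extendPath X ω t - extendPath X ω s| ≤ C * |t - s| ^ α := by
  refine (h (projIcc 0 1 zero_le_one s) (projIcc 0 1 zero_le_one t)).trans ?_
  refine mul_le_mul_of_nonneg_left (Real.rpow_le_rpow (abs_nonneg _) ?_ hα.le) hC.le
  exact abs_projIcc_sub_projIcc zero_le_one

theorem extendPath_of_mem {u : ℝ} (hu : u ∈ I) (ω : Ω) : extendPath X ω u = X ⟨u, hu⟩ ω :=
  IccExtend_of_mem _ _ hu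

variable [mΩ : MeasurableSpace Ω] {𝓕 : Filtration I mΩ}

theorem measurable_extendPath (hX : Adapted 𝓕 X) {t : I} {u : ℝ} (hu : u ≤ t) :
    Measurable[𝓕 t] fun ω => extendPath X ω u := by
  have h : projIcc 0 1 zero_le_one u ≤ t := by
    rw [← projIcc_val zero_le_one t]
    exact monotone_projIcc _ hu
  exact (hX _).mono (𝓕.mono h) le_rfl

namespace StepStrategy

variable (S : StepStrategy)

theorem measurable_coef (hX : Adapted 𝓕 X) {t : I} {n j : ℕ} (h : S.pt n j ≤ t) :
    Measurable[𝓕 t] fun ω => S.coef (extendPath X ω) n j := by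
  have hm : ∀ i ≤ j, Measurable[𝓕 t] fun ω => extendPath X ω (S.pt n i) := fun i hi =>
    measurable_extendPath hX ((S.pt_mono n hi).trans h)
  have h0 := hm 0 (Nat.zero_le j)
  refine Measurable.ite ?_ (((hm j le_rfl).sub h0).const_mul _) measurable_const
  have : {ω | ∀ i ≤ j, |extendPath X ω (S.pt n i) - extendPath X ω (S.pt n 0)| < S.level n} =
      ⋂ i ∈ Iic j, {ω | |extendPath X ω (S.pt n i) - extendPath X ω (S.pt n 0)| < S.level n} := by
    ext ω
    simp
  rw [this]
  refine MeasurableSet.biInter (to_countable _) fun i hi => ?_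
  exact measurableSet_lt (measurable_abs.comp ((hm i hi).sub h0)) measurable_const

/-- A coefficient not yet known at time `t` belongs to a step starting after `t`, whose truncated
increment is zero. -/
theorem measurable_gain (hX : Adapted 𝓕 X) (N : ℕ) {t : I} {u : ℝ} (hu : u ≤ t) :
    Measurable[𝓕 t] fun ω => S.gain (extendPath X ω) N u := by
  refine Finset.measurable_fun_sum _ fun n _ => Finset.measurable_fun_sum _ fun j _ => ?_
  rcases le_or_gt (S.pt n j) t with h | h
  · exact (S.measurable_coef hX h).mul
      ((measurable_extendPath hX ((min_le_left _ _).trans hu)).sub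
        (measurable_extendPath hX ((min_le_left _ _).trans hu)))
  · have h1 : u ≤ S.pt n j := hu.trans h.le
    have h2 : u ≤ S.pt n (j + 1) := h1.trans (S.pt_mono n (Nat.le_succ j))
    simp only [min_eq_left h1, min_eq_left h2, sub_self, mul_zero]
    exact measurable_const

theorem measurable_position (hX : Adapted 𝓕 X) (N : ℕ) (t : I) :
    Measurable[𝓕 t] fun ω => S.position (extendPath X ω) N t := by
  refine Finset.measurable_fun_sum _ fun n _ => Finset.measurable_fun_sum _ fun j _ => ?_
  rcases le_or_gt (S.pt n j) t with h | h
  · exact (S.measurable_coef hX h).mul_const _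
  · have h2 : (t : ℝ) < S.pt n (j + 1) := h.trans_le (S.pt_mono n (Nat.le_succ j))
    simp only [GLS.below, indicator, mem_Iio, h, h2, if_true, sub_self, mul_zero]
    exact measurable_const

theorem measurable_stopped (hX : Adapted 𝓕 X) {t : I} {R : Ω → ℝ} (hR : Measurable[𝓕 t] R) :
    Measurable[𝓕 t] fun ω => S.stopped (extendPath X ω) (R ω) t := by
  refine Measurable.ite ?_ (S.measurable_position hX _ t) measurable_const
  have : {ω | S.Running (extendPath X ω) (R ω) t} = ⋃ k : ℕ, ⋂ q : ℚ,
      {ω | S.gain (extendPath X ω) (S.horizon t) (min t (max (S.node 0) q)) ≤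
        R ω - 1 / ((k : ℝ) + 1)} := by
    ext ω
    simp [Running]
  rw [this]
  exact MeasurableSet.iUnion fun k => MeasurableSet.iInter fun q =>
    measurableSet_le (S.measurable_gain hX _ (min_le_left _ _)) (hR.sub_const _)

theorem stopped_of_lt_node_zero (x : ℝ → ℝ) (R : ℝ) {u : ℝ} (hu : u < S.node 0) :
    S.stopped x R u = 0 := by
  rw [stopped, S.position_of_lt_node_zero x _ hu, ite_self]

/-- On every block but finitely many, the path leaves the ball of radius `2 * level n`. -/
theorem IsTuned.ae_eventually_exit {S : StepStrategy} {P : Measure Ω} [IsProbabilityMeasure P]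
    {α δ v : ℝ} (hS : S.IsTuned α v) (hα : 0 < α) (hv0 : 0 ≤ v) (hv : 1 - δ < v)
    (hSmall : SmallBall P X α δ) :
    ∀ᵐ ω ∂P, ∀ᶠ n in atTop, ∃ u ∈ Icc (S.node n) (S.node (n + 1)),
      2 * S.level n < |extendPath X ω u - extendPath X ω (S.node n)| := by
  obtain ⟨C, hC, hball⟩ := hSmall
  have hge : ∀ n, v ≤ S.node n := fun n =>
    hS.node_zero ▸ S.node_strictMono.monotone (Nat.zero_le n)
  have hmem : ∀ n, S.node n ∈ I := fun n => ⟨hv0.trans (hge n), (hS.node_lt_one n).le⟩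
  let E : ℕ → Set Ω := fun n => {ω | ∀ u ∈ Icc (⟨S.node n, hmem n⟩ : I) ⟨S.node (n + 1), hmem (n + 1)⟩,
    |X u ω - X ⟨S.node n, hmem n⟩ ω| ≤ 2 * S.level n}
  have hE : ∀ n, P (E n) ≤ ENNReal.ofReal (Real.exp (-C) ^ (n + 1)) := by
    intro n
    have hD : 0 < S.node (n + 1) - S.node n := sub_pos.2 (S.node_lt n)
    have hn : (0 : ℝ) < (n : ℝ) + 1 := by positivity
    have h := hball ⟨S.node n, hmem n⟩ ⟨S.node (n + 1), hmem (n + 1)⟩ (hv.le.trans (hge n))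
      (S.node_lt n) (2 * S.level n) (by linarith [hS.level_pos n]) (by
        rw [hS.level_eq]
        refine Real.rpow_le_rpow (by positivity) (div_le_self hD.le (by linarith)) hα.le)
    rw [← ofReal_measureReal]
    refine ENNReal.ofReal_le_ofReal (h.trans (le_of_eq ?_))
    -- The radius `(D / (n + 1)) ^ α` turns the exponent `-C D ε ^ (-1 / α)` into `-C (n + 1)`, a
    -- summable geometric bound.
    rw [hS.level_eq, ← Real.rpow_mul (by positivity), mul_neg, mul_one_div_cancel hα.ne',
      Real.rpow_neg_one, ← Real.exp_nat_mul]
    congr 1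
    push_cast
    field_simp
  have hsum : ∑' n, P (E n) ≠ ∞ := by
    have hs : Summable fun n : ℕ => Real.exp (-C) ^ (n + 1) :=
      (summable_nat_add_iff 1).2 (summable_geometric_of_lt_one (Real.exp_pos _).le
        (by simpa using hC))
    exact ne_top_of_le_ne_top hs.tsum_ofReal_ne_top (ENNReal.tsum_le_tsum hE)
  filter_upwards [ae_eventually_notMem hsum] with ω hω
  filter_upwards [hω] with n hn
  simp only [E, mem_ofPred_eq, not_forall, not_le] at hn
  obtain ⟨u, hu, hlt⟩ := hn
  refine ⟨u, hu, ?_⟩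
  rw [extendPath_of_mem (hmem n), extendPath_of_mem u.2]
  exact hlt

end StepStrategy

end Paths

end

/-! ### Assembly of the target, the strategy and the integral. -/

theorem mainTheorem4 {Ω : Type*} [mΩ : MeasurableSpace Ω] (P : Measure Ω) [IsProbabilityMeasure P]
    (𝓕 : Filtration I mΩ) (X : I → Ω → ℝ) (hX : Adapted 𝓕 X)
    (α : ℝ) (hα : 1 / 2 < α) (hHolder : HolderPaths P X α)
    (δ : ℝ) (hδ : 0 < δ) (hSmall : SmallBall P X α δ)
    (v : I) (hv : (v : ℝ) ∈ Ioo (1 - δ) 1) (hcont : Continuous (cdf (P.map (X v))))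
    (F : ℝ → ℝ) (hF : IsDistributionFunction F) :
    ∃ β ∈ Ioo (1 - α) 1, ∃ φ : I → Ω → ℝ, Adapted 𝓕 φ ∧
      ∃ ξ : Ω → ℝ, Measurable ξ ∧
        (∀ᵐ ω ∂P, GLS.HasIntegral β 0 1 (extendPath φ ω) (extendPath X ω) (ξ ω)) ∧
        ∀ x, cdf (P.map ξ) x = F x := by
  have hα0 : 0 < α := by linarith
  -- The maximum with `0` keeps the order positive even when `α ≥ 1`.
  obtain ⟨β, hβl, hβ1⟩ : ∃ β, max 0 (1 - α) < β ∧ β < 1 :=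
    exists_between (max_lt zero_lt_one (by linarith))
  have hβ0 : 0 < β := (le_max_left _ _).trans_lt hβl
  have hβα : 1 - α < β := (le_max_right _ _).trans_lt hβl
  obtain ⟨S, hS⟩ := StepStrategy.exists_isTuned hα hv.2
  have hXv : Measurable (X v) := (hX v).mono (𝓕.le v) le_rfl
  have := Measure.isProbabilityMeasure_map (μ := P) hXv.aemeasurable
  have hQ : Measurable fun w => quantile F (cdf (P.map (X v)) w) :=
    (measurable_quantile hF).comp (monotone_cdf _).measurable
  set ξ : Ω → ℝ := fun ω => quantile F (cdf (P.map (X v)) (X v ω)) with hξ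
  have hξv : Measurable[𝓕 v] ξ := hQ.comp (hX v)
  let sgn : ℝ → ℝ := fun y => if 0 ≤ y then 1 else -1
  have hsgn : Measurable sgn := Measurable.ite measurableSet_Ici measurable_const measurable_const
  refine ⟨β, ⟨hβα, hβ1⟩, fun t ω => sgn (ξ ω) * S.stopped (extendPath X ω) |ξ ω| t, ?_, ξ,
    hξv.mono (𝓕.le v) le_rfl, ?_, ?_⟩
  · intro t
    -- Before `v` the position is zero, so the target `ξ` is used only once it is known.
    rcases lt_or_ge t v with ht | ht
    · have : (t : ℝ) < S.node 0 := hS.node_zero ▸ ht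
      simp only [S.stopped_of_lt_node_zero _ _ this, mul_zero]
      exact measurable_const
    · have hξt : Measurable[𝓕 t] ξ := hξv.mono (𝓕.mono ht) le_rfl
      exact (hsgn.comp hξt).mul (S.measurable_stopped hX (measurable_abs.comp hξt))
  · filter_upwards [hHolder, hS.ae_eventually_exit hα0 v.2.1 hv.1 hSmall] with ω ⟨C, hC, hω⟩ hexit
    set x := extendPath X ω
    have hx : ∀ s t, |x t - x s| ≤ C * |t - s| ^ α := extendPath_holder hα0 hC hω
    have hxc := GLS.continuous_of_holder hα0 hx
    -- The number `M` of blocks depends on `ω` but is finite, so the stopped integrand is a genuine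
    -- step function on this path.
    obtain ⟨M, hM⟩ := ((S.tendsto_gain_node x
      (hS.eventually_block_gain hx hexit hα0)).eventually_ge_atTop |ξ ω|).exists
    obtain ⟨τ, hτ, hgain, hstopped⟩ := S.exists_stopping_time hxc (abs_nonneg (ξ ω)) hM
    have hτ0 : 0 ≤ τ := v.2.1.trans (hS.node_zero ▸ hτ.1)
    have hmem : ∀ n j, min τ (S.pt n j) ∈ Icc (0 : ℝ) 1 := fun n j =>
      ⟨le_min hτ0 (v.2.1.trans (hS.node_zero ▸ (S.node_strictMono.monotone (Nat.zero_le n)).trans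
        (S.node_le_pt n j))), (min_le_left _ _).trans (hτ.2.trans (hS.node_lt_one M).le)⟩
    have key := GLS.hasIntegral_stepFun_sub
      ((Finset.range M).sigma fun n => Finset.range (S.steps n))
      (fun p => sgn (ξ ω) * S.coef x p.1 p.2) (fun p => min τ (S.pt p.1 (p.2 + 1)))
      (fun p => min τ (S.pt p.1 p.2)) hα0 hβα hβ0 hβ1 hx (fun p _ => hmem _ _) (fun p _ => hmem _ _)
    have hval : ∑ p ∈ (Finset.range M).sigma fun n => Finset.range (S.steps n),
        sgn (ξ ω) * S.coef x p.1 p.2 *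
          (x (min τ (S.pt p.1 (p.2 + 1))) - x (min τ (S.pt p.1 p.2))) = ξ ω := by
      simp_rw [mul_assoc]
      rw [← Finset.mul_sum, Finset.sum_sigma]
      change sgn (ξ ω) * S.gain x M τ = ξ ω
      rw [hgain]
      simp only [sgn]
      split_ifs with h
      · rw [one_mul, abs_of_nonneg h]
      · rw [abs_of_neg (not_le.1 h)]
        ring
    rw [hval] at key
    refine key.congr fun u hu => ?_
    rw [extendPath_of_mem ⟨hu.1.le, hu.2⟩]
    simp_rw [mul_assoc]
    rw [← Finset.mul_sum, Finset.sum_sigma, hstopped]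
  · intro y
    have h := cdf_map_quantile hF hcont y
    rwa [Measure.map_map hQ hXv] at h
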